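/- Work in the language of second-order arithmetic ($0,S,+,\cdot,<,\in$), whose structures are pairs $(M,\mathcal X)$ with $\mathcal X\subseteq\mathcal P(M)$; number quantifiers range over $M$, set quantifiers over $\mathcal X$. Write $\Sigma^0_n,\Pi^0_n$ for the usual classes of formulas without set quantifiers, with number and set parameters permitted. Let $\mathrm{RCA}_0^*$ be the theory consisting of Robinson arithmetic, $\mathrm B\Sigma^0_1$ (collection for $\Sigma^0_1$ formulas together, as usual, with induction for $\Delta^0_0$ formulas), the statement $\exp$ that $2^n$ exists for every $n$, and comprehension for $\Delta^0_1$ formulas. Fix the pairing function $\langle a,b\rangle=(a+b)^2+a$, and for a set $R$ let $R_k=\{x:\langle k,x\rangle\in R\}$. Let $\text{fin-}\mathrm{COH}$ be the statement: for every number $\ell$ and every sequence of sets $(R_k)_{k<\ell}$ of length $\ell$ (given by a set $R$) there is an infinite (that is, unbounded) set $H$ such that for every $k<\ell$, either all sufficiently large elements of $H$ belong to $R_k$, or all sufficiently large elements of $H$ belong to the complement of $R_k$. Let $\mathrm I\Sigma^0_1$ be the scheme of induction for $\Sigma^0_1$ formulas. **Theorem.** $\mathrm{RCA}_0^*+\text{fin-}\mathrm{COH}\vdash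 \mathrm I\Sigma^0_1$. That is, every model $(M,\mathcal X)$ of $\mathrm{RCA}_0^*+\text{fin-}\mathrm{COH}$ satisfies every instance of $\mathrm I\Sigma^0_1$. -/

import Mathlib

universe u

namespace SOA

/-- Terms of the language `0, S, +, ·, <, ∈` of second-order arithmetic in which the free number
variables are `0, …, n - 1` (de Bruijn indices: `0` is the most recently bound variable). -/
inductive Tm (n : ℕ) : Type
  | var : Fin n → Tm n
  | zero : Tm n
  | succ : Tm n → Tm n
  | add : Tm n → Tm n → Tm n
  | mul : Tm n → Tm n → Tm n

/-- `Fm m n`: formulas of second-order arithmetic with free set variables `0, …, m - 1` and free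
number variables `0, …, n - 1`; `all`, `ex` quantify over numbers, `allS`, `exS` over sets. -/
inductive Fm : ℕ → ℕ → Type
  | eq {m n : ℕ} : Tm n → Tm n → Fm m n
  | lt {m n : ℕ} : Tm n → Tm n → Fm m n
  | mem {m n : ℕ} : Tm n → Fin m → Fm m n
  | neg {m n : ℕ} : Fm m n → Fm m n
  | and {m n : ℕ} : Fm m n → Fm m n → Fm m n
  | or {m n : ℕ} : Fm m n → Fm m n → Fm m n
  | imp {m n : ℕ} : Fm m n → Fm m n → Fm m n
  | all {m n : ℕ} : Fm m (n + 1) → Fm m n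
  | ex {m n : ℕ} : Fm m (n + 1) → Fm m n
  | allS {m n : ℕ} : Fm (m + 1) n → Fm m n
  | exS {m n : ℕ} : Fm (m + 1) n → Fm m n

prefix:max "♯" => Tm.var
infix:62 " ≐ " => Fm.eq
infix:62 " ≺ " => Fm.lt
infix:62 " ∊ " => Fm.mem
prefix:61 "∼" => Fm.neg
infixr:60 " ⋏ " => Fm.and
infixr:59 " ⋎ " => Fm.or
infixr:58 " ⟹ " => Fm.imp

instance (n : ℕ) : Zero (Tm n) := ⟨Tm.zero⟩
instance (n : ℕ) : One (Tm n) := ⟨Tm.succ 0⟩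
instance (n : ℕ) : Add (Tm n) := ⟨Tm.add⟩
instance (n : ℕ) : Mul (Tm n) := ⟨Tm.mul⟩

/-- Sentences: no free variables of either sort. -/
abbrev Sentence : Type := Fm 0 0

/-- A theory is a set of sentences. -/
abbrev Theory : Type := Set Sentence

/-! ### Structures and satisfaction -/

/-- A structure `(M, 𝒳)` for second-order arithmetic: a first-order part with carrier `M`, and a
family `𝒳` of subsets of `M` over which the set quantifiers range. -/
structure Str where
  carrier : Type u
  zero : carrier
  succ : carrier → carrier
  add : carrier → carrier → carrier
  mul : carrier → carrier → carrier
  lt : carrier → carrier → Prop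
  sets : Set (Set carrier)

/-- Value of a term in a structure. -/
def Tm.eval (S : Str.{u}) {n : ℕ} (v : Fin n → S.carrier) : Tm n → S.carrier
  | .var i => v i
  | .zero => S.zero
  | .succ t => S.succ (t.eval S v)
  | .add s t => S.add (s.eval S v) (t.eval S v)
  | .mul s t => S.mul (s.eval S v) (t.eval S v)

/-- Satisfaction of a formula under an assignment `A` of the set variables and `v` of the number
variables. -/
def Fm.Sat (S : Str.{u}) : {m n : ℕ} → Fm m n →
    (Fin m → Set S.carrier) → (Fin n → S.carrier) → Prop
  | _, _, .eq s t, _, v => s.eval S v = t.eval S v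
  | _, _, .lt s t, _, v => S.lt (s.eval S v) (t.eval S v)
  | _, _, .mem t X, A, v => t.eval S v ∈ A X
  | _, _, .neg φ, A, v => ¬ φ.Sat S A v
  | _, _, .and φ ψ, A, v => φ.Sat S A v ∧ ψ.Sat S A v
  | _, _, .or φ ψ, A, v => φ.Sat S A v ∨ ψ.Sat S A v
  | _, _, .imp φ ψ, A, v => φ.Sat S A v → ψ.Sat S A v
  | _, _, .all φ, A, v => ∀ x : S.carrier, φ.Sat S A (Matrix.vecCons x v)
  | _, _, .ex φ, A, v => ∃ x : S.carrier, φ.Sat S A (Matrix.vecCons x v)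
  | _, _, .allS φ, A, v => ∀ X ∈ S.sets, φ.Sat S (Matrix.vecCons X A) v
  | _, _, .exS φ, A, v => ∃ X ∈ S.sets, φ.Sat S (Matrix.vecCons X A) v

/-- `(M, 𝒳)` satisfies a sentence. -/
def Str.Satisfies (S : Str.{u}) (φ : Sentence) : Prop := φ.Sat S ![] ![]

/-- `(M, 𝒳)` is a model of a theory. -/
def Str.Models (S : Str.{u}) (T : Theory) : Prop := ∀ φ ∈ T, S.Satisfies φ

/-- `T` entails the sentence `φ`: every model `(M, 𝒳)` of `T` satisfies `φ`. -/
def Theory.Entails (T : Theory) (φ : Sentence) : Prop :=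
  ∀ S : Str.{u}, S.Models T → S.Satisfies φ

/-! ### Substitution and universal closure -/

/-- Simultaneous substitution in terms. -/
def Tm.subst {n k : ℕ} (σ : Fin n → Tm k) : Tm n → Tm k
  | .var i => σ i
  | .zero => .zero
  | .succ t => .succ (t.subst σ)
  | .add s t => .add (s.subst σ) (t.subst σ)
  | .mul s t => .mul (s.subst σ) (t.subst σ)

/-- The same term, read below one more number quantifier. -/
def Tm.shift {n : ℕ} (t : Tm n) : Tm (n + 1) := t.subst (fun i => ♯i.succ)

/-- Simultaneous capture-avoiding substitution of terms for the number variables and of set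
variables for the set variables. -/
def Fm.subst : {m n : ℕ} → Fm m n → {l k : ℕ} → (Fin m → Fin l) → (Fin n → Tm k) → Fm l k
  | _, _, .eq s t, _, _, _, σ => .eq (s.subst σ) (t.subst σ)
  | _, _, .lt s t, _, _, _, σ => .lt (s.subst σ) (t.subst σ)
  | _, _, .mem t X, _, _, ρ, σ => .mem (t.subst σ) (ρ X)
  | _, _, .neg φ, _, _, ρ, σ => .neg (φ.subst ρ σ)
  | _, _, .and φ ψ, _, _, ρ, σ => .and (φ.subst ρ σ) (ψ.subst ρ σ)
  | _, _, .or φ ψ, _, _, ρ, σ => .or (φ.subst ρ σ) (ψ.subst ρ σ)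
  | _, _, .imp φ ψ, _, _, ρ, σ => .imp (φ.subst ρ σ) (ψ.subst ρ σ)
  | _, _, .all φ, _, _, ρ, σ => .all (φ.subst ρ (Matrix.vecCons ♯0 (fun i => (σ i).shift)))
  | _, _, .ex φ, _, _, ρ, σ => .ex (φ.subst ρ (Matrix.vecCons ♯0 (fun i => (σ i).shift)))
  | _, _, .allS φ, _, _, ρ, σ => .allS (φ.subst (Matrix.vecCons 0 (fun i => (ρ i).succ)) σ)
  | _, _, .exS φ, _, _, ρ, σ => .exS (φ.subst (Matrix.vecCons 0 (fun i => (ρ i).succ)) σ)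

/-- Substitution for the number variables only. -/
abbrev Fm.substNum {m n k : ℕ} (φ : Fm m n) (σ : Fin n → Tm k) : Fm m k := φ.subst id σ

/-- Universal closure with respect to the number variables. -/
def Fm.closeNum {m : ℕ} : {n : ℕ} → Fm m n → Fm m 0
  | 0, φ => φ
  | _ + 1, φ => Fm.closeNum (.all φ)

/-- Universal closure with respect to the set variables. -/
def Fm.closeSet : {m : ℕ} → Fm m 0 → Sentence
  | 0, φ => φ
  | _ + 1, φ => Fm.closeSet (.allS φ)

/-- Universal closure. -/
def Fm.close {m n : ℕ} (φ : Fm m n) : Sentence := φ.closeNum.closeSet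

/-! ### Formula classes -/

/-- `∀ x < t, φ(x)`. -/
def Fm.ball {m n : ℕ} (t : Tm n) (φ : Fm m (n + 1)) : Fm m n := .all (♯0 ≺ t.shift ⟹ φ)

/-- `∃ x < t, φ(x)`. -/
def Fm.bex {m n : ℕ} (t : Tm n) (φ : Fm m (n + 1)) : Fm m n := .ex (♯0 ≺ t.shift ⋏ φ)

/-- `Δ⁰₀` formulas: all quantifiers are bounded number quantifiers; free set variables are
permitted. -/
inductive Fm.IsDelta0 : {m n : ℕ} → Fm m n → Prop
  | eq {m n : ℕ} (s t : Tm n) : IsDelta0 (m := m) (s ≐ t)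
  | lt {m n : ℕ} (s t : Tm n) : IsDelta0 (m := m) (s ≺ t)
  | mem {m n : ℕ} (t : Tm n) (X : Fin m) : IsDelta0 (t ∊ X)
  | neg {m n : ℕ} {φ : Fm m n} : IsDelta0 φ → IsDelta0 (∼φ)
  | and {m n : ℕ} {φ ψ : Fm m n} : IsDelta0 φ → IsDelta0 ψ → IsDelta0 (φ ⋏ ψ)
  | or {m n : ℕ} {φ ψ : Fm m n} : IsDelta0 φ → IsDelta0 ψ → IsDelta0 (φ ⋎ ψ)
  | imp {m n : ℕ} {φ ψ : Fm m n} : IsDelta0 φ → IsDelta0 ψ → IsDelta0 (φ ⟹ ψ)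
  | ball {m n : ℕ} (t : Tm n) {φ : Fm m (n + 1)} : IsDelta0 φ → IsDelta0 (Fm.ball t φ)
  | bex {m n : ℕ} (t : Tm n) {φ : Fm m (n + 1)} : IsDelta0 φ → IsDelta0 (Fm.bex t φ)

/-- `Σ⁰₁` formulas: a block of existential number quantifiers before a `Δ⁰₀` formula. -/
inductive Fm.IsSigma1 : {m n : ℕ} → Fm m n → Prop
  | delta0 {m n : ℕ} {φ : Fm m n} : φ.IsDelta0 → IsSigma1 φ
  | ex {m n : ℕ} {φ : Fm m (n + 1)} : IsSigma1 φ → IsSigma1 (.ex φ)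

/-- `Π⁰₁` formulas: a block of universal number quantifiers before a `Δ⁰₀` formula. -/
inductive Fm.IsPi1 : {m n : ℕ} → Fm m n → Prop
  | delta0 {m n : ℕ} {φ : Fm m n} : φ.IsDelta0 → IsPi1 φ
  | all {m n : ℕ} {φ : Fm m (n + 1)} : IsPi1 φ → IsPi1 (.all φ)

/-! ### Axioms and theories -/

/-- Robinson arithmetic. -/
def robinsonQ : Theory :=
  { -- `∀ x, S x ≠ 0`
    .all (∼(.succ ♯0 ≐ 0)),
    -- `∀ x y, S x = S y → x = y`
    .all (.all (.succ ♯1 ≐ .succ ♯0 ⟹ ♯1 ≐ ♯0)),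
    -- `∀ x, x ≠ 0 → ∃ y, x = S y`
    .all (∼(♯0 ≐ 0) ⟹ .ex (♯1 ≐ .succ ♯0)),
    -- `∀ x, x + 0 = x`
    .all (♯0 + 0 ≐ ♯0),
    -- `∀ x y, x + S y = S (x + y)`
    .all (.all (♯1 + .succ ♯0 ≐ .succ (♯1 + ♯0))),
    -- `∀ x, x · 0 = 0`
    .all (♯0 * 0 ≐ 0),
    -- `∀ x y, x · S y = x · y + x`
    .all (.all (♯1 * .succ ♯0 ≐ ♯1 * ♯0 + ♯1)),
    -- `∀ x y, x < y ↔ ∃ z, z + S x = y`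
    .all (.all ((♯1 ≺ ♯0 ⟹ .ex (♯0 + .succ ♯2 ≐ ♯1)) ⋏
      (.ex (♯0 + .succ ♯2 ≐ ♯1) ⟹ ♯1 ≺ ♯0))) }

/-- Induction for `φ(x)`: `φ(0) ∧ ∀ x (φ(x) → φ(S x)) → ∀ x φ(x)`. -/
def Fm.induction {m n : ℕ} (φ : Fm m (n + 1)) : Fm m n :=
  (φ.substNum (Matrix.vecCons 0 (fun i => ♯i)) ⋏
    .all (φ ⟹ φ.substNum (Matrix.vecCons (.succ ♯0) (fun i => ♯i.succ)))) ⟹ .all φ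

/-- Collection for `φ(y, x)` (`y` is variable `0` and `x` is variable `1`):
`∀ a (∀ x < a ∃ y φ(y, x) → ∃ b ∀ x < a ∃ y < b φ(y, x))`. -/
def Fm.collection {m n : ℕ} (φ : Fm m (n + 2)) : Fm m n :=
  .all (Fm.ball ♯0 (.ex (φ.substNum
      (Matrix.vecCons ♯0 (Matrix.vecCons ♯1 (fun i => ♯i.succ.succ.succ))))) ⟹
    .ex (Fm.ball ♯1 (Fm.bex ♯1 (φ.substNum
      (Matrix.vecCons ♯0 (Matrix.vecCons ♯1 (fun i => ♯i.succ.succ.succ.succ)))))))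

/-- Comprehension for `φ(x)` given that it is equivalent to `ψ(x)`:
`∀ x (φ(x) ↔ ψ(x)) → ∃ X ∀ x (x ∈ X ↔ φ(x))`. -/
def Fm.comprehension {m n : ℕ} (φ ψ : Fm m (n + 1)) : Fm m n :=
  .all ((φ ⟹ ψ) ⋏ (ψ ⟹ φ)) ⟹
    .exS (.all ((♯0 ∊ 0 ⟹ φ.subst Fin.succ (fun i => ♯i)) ⋏
      (φ.subst Fin.succ (fun i => ♯i) ⟹ ♯0 ∊ 0)))

/-- The induction scheme for `Δ⁰₀` formulas, with number and set parameters. -/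
def IDelta0 : Theory :=
  {χ | ∃ (m n : ℕ) (φ : Fm m (n + 1)), φ.IsDelta0 ∧ χ = φ.induction.close}

/-- The induction scheme for `Σ⁰₁` formulas, with number and set parameters. -/
def ISigma1 : Theory :=
  {χ | ∃ (m n : ℕ) (φ : Fm m (n + 1)), φ.IsSigma1 ∧ χ = φ.induction.close}

/-- The theory `BΣ⁰₁`: collection for `Σ⁰₁` formulas, together (as usual) with `Δ⁰₀` induction. -/
def BSigma1 : Theory :=
  IDelta0 ∪ {χ | ∃ (m n : ℕ) (φ : Fm m (n + 2)), φ.IsSigma1 ∧ χ = φ.collection.close}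

/-- Comprehension for `Δ⁰₁` formulas. -/
def Delta1CA : Theory :=
  {χ | ∃ (m n : ℕ) (φ ψ : Fm m (n + 1)), φ.IsSigma1 ∧ ψ.IsPi1 ∧
    χ = (φ.comprehension ψ).close}

/-- `r` is the remainder of `a` modulo `1 + (i + 1) · b`, that is, `r = β(a, b, i)` for Gödel's
`β` function. -/
def betaEq {m n : ℕ} (a b i r : Tm n) : Fm m n :=
  r ≺ .succ (.succ i * b) ⋏ .ex (a.shift ≐ ♯0 * (Tm.succ (.succ i * b)).shift + r.shift)

/-- `y = 2 ^ n`: there are `a, b` with `β(a, b, 0) = 1`, `β(a, b, i + 1) = 2 · β(a, b, i)` for all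
`i < n`, and `β(a, b, n) = y`. -/
def powTwoEq {m k : ℕ} (n y : Tm k) : Fm m k :=
  .ex (.ex (betaEq ♯1 ♯0 0 1 ⋏
    Fm.ball n.shift.shift
      (.ex (betaEq ♯3 ♯2 ♯1 ♯0 ⋏ betaEq ♯3 ♯2 (.succ ♯1) (♯0 + ♯0))) ⋏
    betaEq ♯1 ♯0 n.shift.shift y.shift.shift))

/-- Totality of exponentiation: `∀ n ∃ y, y = 2 ^ n`. -/
def expTotal : Sentence := .all (.ex (powTwoEq ♯1 ♯0))

/-- The theory `RCA₀*`. -/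
def RCA0star : Theory := robinsonQ ∪ BSigma1 ∪ {expTotal} ∪ Delta1CA

/-- The code `⟨a, b⟩ = (a + b)² + a` of an ordered pair. -/
def Tm.pair {n : ℕ} (a b : Tm n) : Tm n := (a + b) * (a + b) + a

/-- The finite cohesiveness principle. A set `R` is the sequence of its sections
`R_k = {x | ⟨k, x⟩ ∈ R}`, and the principle says: for every `ℓ` and every `R` there is `H` with
`∀ b ∃ a, a ∈ H ∧ b < a` such that, for every `k < ℓ`, either
`∃ b ∀ x, b < x → x ∈ H → x ∈ R_k` or `∃ b ∀ x, b < x → x ∈ H → x ∉ R_k`.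
(Below, `R` is set variable `1` and `H` is set variable `0`.) -/
def finCOH : Sentence :=
  .all (.allS (.exS (
    .all (.ex (♯0 ∊ 0 ⋏ ♯1 ≺ ♯0)) ⋏
    Fm.ball ♯0
      (.ex (.all (♯1 ≺ ♯0 ⟹ ♯0 ∊ 0 ⟹ Tm.pair ♯2 ♯0 ∊ 1)) ⋎
       .ex (.all (♯1 ≺ ♯0 ⟹ ♯0 ∊ 0 ⟹ ∼(Tm.pair ♯2 ♯0 ∊ 1)))))))

end SOA

/-! Failures of `Σ⁰₁` induction contradict finite cohesiveness over `RCA₀*`. -/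

/-! Suppose induction fails for `∃ y, P y x` with `P` a `Δ⁰₀` relation: the property holds at `0`,
passes to successors, and fails at `b`. Let `f w` be the least `x` with no witness below `w`. Then
`f` is nondecreasing and bounded by `b`, yet has no largest value (`exists_bounded_growing`).

Read a number `s < 2 ^ (b + 1)` as a string of binary digits in positions `0, …, b`, and let `R_s`
be the set of `x` at which the digit of `s` in position `f x` is `1`. There are only `2 ^ (b + 1)`
such sets, so finite cohesiveness gives an unbounded `H` on which every `R_s` is eventually
constant. But some `s` has digits that alternate along consecutive values of `f` on `H`, so `R_s`
changes arbitrarily far out in `H`, a contradiction.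

Below each `z` such an `s` is built by `Δ⁰₀` induction: values of `f` only go up, so a new value
calls for one new digit and leaves the lower ones alone (`exists_alternating_below`,
`PowSeq.exists_bit`). One `s` works for all `z` at once by collection: otherwise each `s` has a
counterexample, and these would have a common bound (`Str.IsCohModel.sigma1_induction`).

The rest is coding. `Delta0Rel` replaces syntax by closure properties, `Str.Arith` recovers an
ordered semiring from `Δ⁰₀` induction, and `PowSeq` gives digits a `Δ⁰₀` definition from one
`β`-coded sequence of powers of two. -/

namespace SOA

section

variable {S : Str.{u}}

/-! ### Satisfaction and substitution -/

theorem Tm.eval_subst {n k : ℕ} (t : Tm n) (σ : Fin n → Tm k) (v : Fin k → S.carrier) :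
    (t.subst σ).eval S v = t.eval S (fun i => (σ i).eval S v) := by
  induction t with
  | var i => rfl
  | zero => rfl
  | succ t ih => simp [Tm.subst, Tm.eval, ih]
  | add s t ihs iht => simp [Tm.subst, Tm.eval, ihs, iht]
  | mul s t ihs iht => simp [Tm.subst, Tm.eval, ihs, iht]

theorem Tm.eval_shift {n : ℕ} (t : Tm n) (x : S.carrier) (v : Fin n → S.carrier) :
    t.shift.eval S (Matrix.vecCons x v) = t.eval S v := by
  simp [Tm.shift, Tm.eval_subst, Tm.eval]

theorem eval_vecCons_shift {n k : ℕ} (σ : Fin n → Tm k) (x : S.carrier) (v : Fin k → S.carrier) :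
    (fun i => (Matrix.vecCons (Tm.var 0) (fun i => (σ i).shift) i : Tm (k + 1)).eval S
      (Matrix.vecCons x v)) = Matrix.vecCons x (fun i => (σ i).eval S v) := by
  funext i
  refine Fin.cases ?_ (fun j => ?_) i
  · simp [Tm.eval]
  · simp [Tm.eval_shift]

theorem vecCons_comp_vecCons_succ {m l : ℕ} (ρ : Fin m → Fin l) (X : Set S.carrier)
    (A : Fin l → Set S.carrier) :
    (fun i => Matrix.vecCons X A ((Matrix.vecCons 0 (fun i => (ρ i).succ) : Fin (m + 1) → _) i)) =
      Matrix.vecCons X (fun i => A (ρ i)) := by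
  funext i
  refine Fin.cases ?_ (fun j => ?_) i <;> simp

theorem Fm.sat_subst {m n : ℕ} (φ : Fm m n) : ∀ {l k : ℕ} (ρ : Fin m → Fin l) (σ : Fin n → Tm k)
    (A : Fin l → Set S.carrier) (v : Fin k → S.carrier),
    (φ.subst ρ σ).Sat S A v ↔ φ.Sat S (fun i => A (ρ i)) (fun i => (σ i).eval S v) := by
  induction φ with
  | eq s t => intros; simp [Fm.subst, Fm.Sat, Tm.eval_subst]
  | lt s t => intros; simp [Fm.subst, Fm.Sat, Tm.eval_subst]
  | mem t X => intros; simp [Fm.subst, Fm.Sat, Tm.eval_subst]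
  | neg φ ih => intros; simp [Fm.subst, Fm.Sat, ih]
  | and φ ψ ih₁ ih₂ => intros; simp [Fm.subst, Fm.Sat, ih₁, ih₂]
  | or φ ψ ih₁ ih₂ => intros; simp [Fm.subst, Fm.Sat, ih₁, ih₂]
  | imp φ ψ ih₁ ih₂ => intros; simp [Fm.subst, Fm.Sat, ih₁, ih₂]
  | all φ ih => intros; simp only [Fm.subst, Fm.Sat, ih, eval_vecCons_shift]
  | ex φ ih => intros; simp only [Fm.subst, Fm.Sat, ih, eval_vecCons_shift]
  | allS φ ih => intros; simp only [Fm.subst, Fm.Sat, ih, vecCons_comp_vecCons_succ]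
  | exS φ ih => intros; simp only [Fm.subst, Fm.Sat, ih, vecCons_comp_vecCons_succ]

/-- Needed so that the bound of a bounded quantifier is still a shifted term after substitution,
which keeps `Δ⁰₀` formulas closed under `Fm.subst`. -/
theorem Tm.shift_subst {n k : ℕ} (t : Tm n) (σ : Fin n → Tm k) :
    t.shift.subst (Matrix.vecCons (Tm.var 0) (fun i => (σ i).shift)) = (t.subst σ).shift := by
  induction t with
  | var i => simp [Tm.shift, Tm.subst]
  | zero => rfl
  | succ t ih => simpa [Tm.shift, Tm.subst] using ih
  | add s t ihs iht => simpa [Tm.shift, Tm.subst] using ⟨ihs, iht⟩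
  | mul s t ihs iht => simpa [Tm.shift, Tm.subst] using ⟨ihs, iht⟩

theorem Fm.IsDelta0.subst {m n : ℕ} {φ : Fm m n} (h : φ.IsDelta0) :
    ∀ {l k : ℕ} (ρ : Fin m → Fin l) (σ : Fin n → Tm k), (φ.subst ρ σ).IsDelta0 := by
  induction h with
  | eq s t => intros; exact .eq _ _
  | lt s t => intros; exact .lt _ _
  | mem t X => intros; exact .mem _ _
  | neg _ ih => intro _ _ ρ σ; exact .neg (ih ρ σ)
  | and _ _ ih₁ ih₂ => intro _ _ ρ σ; exact .and (ih₁ ρ σ) (ih₂ ρ σ)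
  | or _ _ ih₁ ih₂ => intro _ _ ρ σ; exact .or (ih₁ ρ σ) (ih₂ ρ σ)
  | imp _ _ ih₁ ih₂ => intro _ _ ρ σ; exact .imp (ih₁ ρ σ) (ih₂ ρ σ)
  | ball t _ ih =>
    intro _ _ ρ σ
    have := IsDelta0.ball (t.subst σ) (ih ρ (Matrix.vecCons (Tm.var 0) (fun i => (σ i).shift)))
    rw [Fm.ball, ← Tm.shift_subst] at this
    exact this
  | bex t _ ih =>
    intro _ _ ρ σ
    have := IsDelta0.bex (t.subst σ) (ih ρ (Matrix.vecCons (Tm.var 0) (fun i => (σ i).shift)))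
    rw [Fm.bex, ← Tm.shift_subst] at this
    exact this

theorem Fm.sat_ball {m n : ℕ} (t : Tm n) (φ : Fm m (n + 1)) (A : Fin m → Set S.carrier)
    (v : Fin n → S.carrier) :
    (Fm.ball t φ).Sat S A v ↔ ∀ x, S.lt x (t.eval S v) → φ.Sat S A (Matrix.vecCons x v) := by
  simp [Fm.ball, Fm.Sat, Tm.eval_shift, Tm.eval]

theorem Fm.sat_bex {m n : ℕ} (t : Tm n) (φ : Fm m (n + 1)) (A : Fin m → Set S.carrier)
    (v : Fin n → S.carrier) :
    (Fm.bex t φ).Sat S A v ↔ ∃ x, S.lt x (t.eval S v) ∧ φ.Sat S A (Matrix.vecCons x v) := by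
  simp [Fm.bex, Fm.Sat, Tm.eval_shift, Tm.eval]

theorem Fm.sat_closeNum {m n : ℕ} (φ : Fm m n) (A : Fin m → Set S.carrier) :
    φ.closeNum.Sat S A ![] ↔ ∀ v, φ.Sat S A v := by
  induction n with
  | zero => exact ⟨fun h v => by rwa [Subsingleton.elim v ![]], fun h => h _⟩
  | succ n ih =>
    rw [Fm.closeNum, ih]
    refine ⟨fun h v => ?_, fun h v x => h _⟩
    have := h (Matrix.vecTail v) (Matrix.vecHead v)
    rwa [Matrix.cons_head_tail] at this

theorem Fm.sat_closeSet {m : ℕ} (φ : Fm m 0) :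
    φ.closeSet.Sat S ![] ![] ↔ ∀ A : Fin m → Set S.carrier, (∀ i, A i ∈ S.sets) → φ.Sat S A ![] := by
  induction m with
  | zero =>
    refine ⟨fun h A _ => ?_, fun h => h _ (fun i => i.elim0)⟩
    rw [Subsingleton.elim A ![]]
    exact h
  | succ m ih =>
    rw [Fm.closeSet, ih]
    refine ⟨fun h A hA => ?_, fun h A hA X hX => h _ (Fin.cases hX hA)⟩
    have := h (Matrix.vecTail A) (fun i => hA _) (Matrix.vecHead A) (hA _)
    rwa [Matrix.cons_head_tail] at this

theorem Fm.satisfies_close {m n : ℕ} (φ : Fm m n) :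
    S.Satisfies φ.close ↔
      ∀ A : Fin m → Set S.carrier, (∀ i, A i ∈ S.sets) → ∀ v, φ.Sat S A v := by
  simp only [Str.Satisfies, Fm.close, Fm.sat_closeSet, Fm.sat_closeNum]

/-! ### Relations definable by `Δ⁰₀` formulas with parameters -/

instance : Zero S.carrier := ⟨S.zero⟩
instance : One S.carrier := ⟨S.succ S.zero⟩
instance : Add S.carrier := ⟨S.add⟩
instance : Mul S.carrier := ⟨S.mul⟩
instance : LT S.carrier := ⟨S.lt⟩

/-- The environment in which every variable is either one of the arguments `v` or a parameter. -/
def env {N n : ℕ} (τ : Fin N → Fin n ⊕ S.carrier) (v : Fin n → S.carrier) : Fin N → S.carrier :=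
  fun i => Sum.elim v id (τ i)

/-- Functions given by terms with parameters. -/
def TermFun {n : ℕ} (t : (Fin n → S.carrier) → S.carrier) : Prop :=
  ∃ (N : ℕ) (τ : Fin N → Fin n ⊕ S.carrier) (s : Tm N), ∀ v, t v = s.eval S (env τ v)

/-- Relations defined by `Δ⁰₀` formulas with number and set parameters. -/
def Delta0Rel {n : ℕ} (P : (Fin n → S.carrier) → Prop) : Prop :=
  ∃ (m N : ℕ) (A : Fin m → Set S.carrier) (τ : Fin N → Fin n ⊕ S.carrier) (φ : Fm m N),
    (∀ i, A i ∈ S.sets) ∧ φ.IsDelta0 ∧ ∀ v, P v ↔ φ.Sat S A (env τ v)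

theorem env_append_left {N₁ N₂ n : ℕ} (τ₁ : Fin N₁ → Fin n ⊕ S.carrier)
    (τ₂ : Fin N₂ → Fin n ⊕ S.carrier) (v : Fin n → S.carrier) :
    (fun i => (Tm.var (Fin.castAdd N₂ i)).eval S (env (Fin.append τ₁ τ₂) v)) = env τ₁ v := by
  funext i
  simp [Tm.eval, env]

theorem env_append_right {N₁ N₂ n : ℕ} (τ₁ : Fin N₁ → Fin n ⊕ S.carrier)
    (τ₂ : Fin N₂ → Fin n ⊕ S.carrier) (v : Fin n → S.carrier) :
    (fun i => (Tm.var (Fin.natAdd N₁ i)).eval S (env (Fin.append τ₁ τ₂) v)) = env τ₂ v := by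
  funext i
  simp [Tm.eval, env]

/-! ### Closure properties of terms with parameters -/

namespace TermFun

variable {n : ℕ} {s t : (Fin n → S.carrier) → S.carrier}

theorem var (i : Fin n) : TermFun (fun v : Fin n → S.carrier => v i) :=
  ⟨1, fun _ => .inl i, .var 0, fun _ => rfl⟩

theorem const (c : S.carrier) : TermFun (fun _ : Fin n → S.carrier => c) :=
  ⟨1, fun _ => .inr c, .var 0, fun _ => rfl⟩

theorem common (hs : TermFun s) (ht : TermFun t) :
    ∃ (N : ℕ) (τ : Fin N → Fin n ⊕ S.carrier) (s' t' : Tm N),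
      ∀ v, s v = s'.eval S (env τ v) ∧ t v = t'.eval S (env τ v) := by
  obtain ⟨N₁, τ₁, s', hs⟩ := hs
  obtain ⟨N₂, τ₂, t', ht⟩ := ht
  refine ⟨N₁ + N₂, Fin.append τ₁ τ₂, s'.subst (fun i => .var (Fin.castAdd N₂ i)),
    t'.subst (fun i => .var (Fin.natAdd N₁ i)), fun v => ?_⟩
  rw [Tm.eval_subst, Tm.eval_subst, env_append_left, env_append_right]
  exact ⟨hs v, ht v⟩

theorem succ (ht : TermFun t) : TermFun (fun v => S.succ (t v)) := by
  obtain ⟨N, τ, t', ht⟩ := ht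
  exact ⟨N, τ, .succ t', fun v => by dsimp only; rw [ht]; rfl⟩

theorem add (hs : TermFun s) (ht : TermFun t) : TermFun (fun v => s v + t v) := by
  obtain ⟨N, τ, s', t', h⟩ := hs.common ht
  exact ⟨N, τ, .add s' t', fun v => by dsimp only; rw [(h v).1, (h v).2]; rfl⟩

theorem mul (hs : TermFun s) (ht : TermFun t) : TermFun (fun v => s v * t v) := by
  obtain ⟨N, τ, s', t', h⟩ := hs.common ht
  exact ⟨N, τ, .mul s' t', fun v => by dsimp only; rw [(h v).1, (h v).2]; rfl⟩

theorem tail (ht : TermFun t) :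
    TermFun (fun w : Fin (n + 1) → S.carrier => t (fun i => w i.succ)) := by
  obtain ⟨N, τ, s, h⟩ := ht
  refine ⟨N, fun i => Sum.map Fin.succ id (τ i), s, fun v => ?_⟩
  dsimp only
  rw [h]
  congr 1
  funext i
  rcases hi : τ i with j | c <;> simp [env, hi]

end TermFun

/-! ### Closure properties of `Δ⁰₀` relations -/

namespace Delta0Rel

variable {n : ℕ} {s t : (Fin n → S.carrier) → S.carrier} {P Q : (Fin n → S.carrier) → Prop}

theorem eq (hs : TermFun s) (ht : TermFun t) : Delta0Rel (fun v => s v = t v) := by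
  obtain ⟨N, τ, s', t', h⟩ := hs.common ht
  exact ⟨0, N, ![], τ, .eq s' t', fun i => i.elim0, .eq _ _, fun v => by
    dsimp only; rw [(h v).1, (h v).2]; rfl⟩

theorem lt (hs : TermFun s) (ht : TermFun t) : Delta0Rel (fun v => s v < t v) := by
  obtain ⟨N, τ, s', t', h⟩ := hs.common ht
  exact ⟨0, N, ![], τ, .lt s' t', fun i => i.elim0, .lt _ _, fun v => by
    dsimp only; rw [(h v).1, (h v).2]; rfl⟩

theorem mem (ht : TermFun t) {X : Set S.carrier} (hX : X ∈ S.sets) :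
    Delta0Rel (fun v => t v ∈ X) := by
  obtain ⟨N, τ, t', h⟩ := ht
  exact ⟨1, N, fun _ => X, τ, .mem t' 0, fun _ => hX, .mem _ _, fun v => by dsimp only; rw [h v]; rfl⟩

theorem not (hP : Delta0Rel P) : Delta0Rel (fun v => ¬ P v) := by
  obtain ⟨m, N, A, τ, φ, hA, hφ, h⟩ := hP
  exact ⟨m, N, A, τ, .neg φ, hA, .neg hφ, fun v => not_congr (h v)⟩

/-- Concatenating the two lists of variables and of set parameters puts both formulas in one
context, where connectives can join them. -/
theorem common (hP : Delta0Rel P) (hQ : Delta0Rel Q) :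
    ∃ (m N : ℕ) (A : Fin m → Set S.carrier) (τ : Fin N → Fin n ⊕ S.carrier) (φ ψ : Fm m N),
      (∀ i, A i ∈ S.sets) ∧ φ.IsDelta0 ∧ ψ.IsDelta0 ∧
      ∀ v, (P v ↔ φ.Sat S A (env τ v)) ∧ (Q v ↔ ψ.Sat S A (env τ v)) := by
  obtain ⟨m₁, N₁, A₁, τ₁, φ, hA₁, hφ, hP⟩ := hP
  obtain ⟨m₂, N₂, A₂, τ₂, ψ, hA₂, hψ, hQ⟩ := hQ
  refine ⟨m₁ + m₂, N₁ + N₂, Fin.append A₁ A₂, Fin.append τ₁ τ₂,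
    φ.subst (Fin.castAdd m₂) (fun i => .var (Fin.castAdd N₂ i)),
    ψ.subst (Fin.natAdd m₁) (fun i => .var (Fin.natAdd N₁ i)), ?_, hφ.subst _ _, hψ.subst _ _,
    fun v => ?_⟩
  · intro i
    refine Fin.addCases (fun j => ?_) (fun j => ?_) i
    · simpa using hA₁ j
    · simpa using hA₂ j
  · rw [Fm.sat_subst, Fm.sat_subst, env_append_left, env_append_right]
    simp only [Fin.append_left, Fin.append_right]
    exact ⟨hP v, hQ v⟩

theorem and (hP : Delta0Rel P) (hQ : Delta0Rel Q) : Delta0Rel (fun v => P v ∧ Q v) := by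
  obtain ⟨m, N, A, τ, φ, ψ, hA, hφ, hψ, h⟩ := hP.common hQ
  exact ⟨m, N, A, τ, .and φ ψ, hA, .and hφ hψ, fun v => and_congr (h v).1 (h v).2⟩

theorem or (hP : Delta0Rel P) (hQ : Delta0Rel Q) : Delta0Rel (fun v => P v ∨ Q v) := by
  obtain ⟨m, N, A, τ, φ, ψ, hA, hφ, hψ, h⟩ := hP.common hQ
  exact ⟨m, N, A, τ, .or φ ψ, hA, .or hφ hψ, fun v => or_congr (h v).1 (h v).2⟩

theorem imp (hP : Delta0Rel P) (hQ : Delta0Rel Q) : Delta0Rel (fun v => P v → Q v) := by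
  obtain ⟨m, N, A, τ, φ, ψ, hA, hφ, hψ, h⟩ := hP.common hQ
  exact ⟨m, N, A, τ, .imp φ ψ, hA, .imp hφ hψ, fun v => imp_congr (h v).1 (h v).2⟩

theorem iff (hP : Delta0Rel P) (hQ : Delta0Rel Q) : Delta0Rel (fun v => P v ↔ Q v) := by
  have := (hP.imp hQ).and (hQ.imp hP)
  simpa only [← iff_iff_implies_and_implies] using this

/-- Arguments may be permuted, identified or frozen at parameters: only the assignment of variables
changes, not the formula. -/
theorem subst_arg {k : ℕ} (hP : Delta0Rel P) (g : Fin n → Fin k ⊕ S.carrier) :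
    Delta0Rel (fun v : Fin k → S.carrier => P (env g v)) := by
  obtain ⟨m, N, A, τ, φ, hA, hφ, h⟩ := hP
  refine ⟨m, N, A, fun i => Sum.elim g Sum.inr (τ i), φ, hA, hφ, fun v => ?_⟩
  dsimp only
  rw [h]
  apply iff_of_eq
  congr 1
  funext i
  rcases hi : τ i with j | c <;> simp [env, hi]

/-- The first argument can be taken to be the variable `0` of the defining formula. -/
theorem exists_formula {P : (Fin (n + 1) → S.carrier) → Prop} (hP : Delta0Rel P) :
    ∃ (m N : ℕ) (A : Fin m → Set S.carrier) (τ : Fin N → Fin n ⊕ S.carrier) (φ : Fm m (N + 1)),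
      (∀ i, A i ∈ S.sets) ∧ φ.IsDelta0 ∧
      ∀ x v, P (Matrix.vecCons x v) ↔ φ.Sat S A (Matrix.vecCons x (env τ v)) := by
  obtain ⟨m, N, A, τ, φ, hA, hφ, h⟩ := hP
  let split : Fin (n + 1) → Option (Fin n) := Fin.cases none some
  -- Variables that stood for the first argument are replaced by variable `0`; their old slots get
  -- the dummy parameter `0`, which is never read.
  refine ⟨m, N, A, fun i => Sum.elim (fun j => (split j).elim (.inr 0) .inl) .inr (τ i),
    φ.subst id (fun i => Sum.elim (fun j => (split j).elim (.var 0) (fun _ => .var i.succ))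
      (fun _ => .var i.succ) (τ i)), hA, hφ.subst _ _, fun x v => ?_⟩
  rw [h, Fm.sat_subst]
  apply iff_of_eq
  congr 1
  funext i
  rcases hi : τ i with j | c
  · refine Fin.cases (fun hi => ?_) (fun j hi => ?_) j hi <;> simp [env, hi, split, Tm.eval]
  · simp [env, hi, Tm.eval]

/-- The first two arguments can be taken to be the variables `0` and `1` of the defining
formula. -/
theorem exists_formula₂ {P : (Fin (n + 2) → S.carrier) → Prop} (hP : Delta0Rel P) :
    ∃ (m N : ℕ) (A : Fin m → Set S.carrier) (τ : Fin N → Fin n ⊕ S.carrier) (φ : Fm m (N + 2)),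
      (∀ i, A i ∈ S.sets) ∧ φ.IsDelta0 ∧
      ∀ x y v, P (Matrix.vecCons x (Matrix.vecCons y v)) ↔
        φ.Sat S A (Matrix.vecCons x (Matrix.vecCons y (env τ v))) := by
  obtain ⟨m, N, A, τ, φ, hA, hφ, h⟩ := hP.exists_formula
  let split : Fin (n + 1) → Option (Fin n) := Fin.cases none some
  refine ⟨m, N, A, fun i => Sum.elim (fun j => (split j).elim (.inr 0) .inl) .inr (τ i),
    φ.subst id (Matrix.vecCons (.var 0) (fun i => Sum.elim
      (fun j => (split j).elim (.var 1) (fun _ => .var i.succ.succ))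
      (fun _ => .var i.succ.succ) (τ i))), hA, hφ.subst _ _, fun x y v => ?_⟩
  rw [h, Fm.sat_subst]
  apply iff_of_eq
  congr 1
  funext i
  refine Fin.cases (by simp [Tm.eval]) (fun i => ?_) i
  rcases hi : τ i with j | c
  · refine Fin.cases (fun hi => ?_) (fun j hi => ?_) j hi <;> simp [env, hi, split, Tm.eval]
  · simp [env, hi, Tm.eval]

theorem common_term {Q : (Fin (n + 1) → S.carrier) → Prop} (ht : TermFun t) (hQ : Delta0Rel Q) :
    ∃ (m N : ℕ) (A : Fin m → Set S.carrier) (τ : Fin N → Fin n ⊕ S.carrier) (t' : Tm N)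
      (φ : Fm m (N + 1)), (∀ i, A i ∈ S.sets) ∧ φ.IsDelta0 ∧ (∀ v, t v = t'.eval S (env τ v)) ∧
      ∀ x v, Q (Matrix.vecCons x v) ↔ φ.Sat S A (Matrix.vecCons x (env τ v)) := by
  obtain ⟨N₁, τ₁, t', ht⟩ := ht
  obtain ⟨m, N₂, A, τ₂, φ, hA, hφ, h⟩ := hQ.exists_formula
  refine ⟨m, N₁ + N₂, A, Fin.append τ₁ τ₂, t'.subst (fun i => .var (Fin.castAdd N₂ i)),
    φ.subst id (Matrix.vecCons (.var 0) (fun i => (Tm.var (Fin.natAdd N₁ i)).shift)), hA,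
    hφ.subst _ _, fun v => ?_, fun x v => ?_⟩
  · rw [Tm.eval_subst, env_append_left, ht]
  · rw [Fm.sat_subst, eval_vecCons_shift, env_append_right]
    exact h x v

theorem ball {P : S.carrier → (Fin n → S.carrier) → Prop} (ht : TermFun t)
    (hP : Delta0Rel (fun w : Fin (n + 1) → S.carrier => P (w 0) (fun i => w i.succ))) :
    Delta0Rel (fun v => ∀ x, x < t v → P x v) := by
  obtain ⟨m, N, A, τ, t', φ, hA, hφ, ht, h⟩ := common_term ht hP
  refine ⟨m, N, A, τ, .ball t' φ, hA, .ball _ hφ, fun v => ?_⟩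
  rw [Fm.sat_ball, ← ht]
  exact forall_congr' fun x => imp_congr_right fun _ => h x v

theorem bex {P : S.carrier → (Fin n → S.carrier) → Prop} (ht : TermFun t)
    (hP : Delta0Rel (fun w : Fin (n + 1) → S.carrier => P (w 0) (fun i => w i.succ))) :
    Delta0Rel (fun v => ∃ x, x < t v ∧ P x v) := by
  obtain ⟨m, N, A, τ, t', φ, hA, hφ, ht, h⟩ := common_term ht hP
  refine ⟨m, N, A, τ, .bex t' φ, hA, .bex _ hφ, fun v => ?_⟩
  rw [Fm.sat_bex, ← ht]
  exact exists_congr fun x => and_congr_right fun _ => h x v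

end Delta0Rel

end

section

/-! ### Ordered semiring structure from `Δ⁰₀` induction -/

/-- Models of Robinson arithmetic with induction for `Δ⁰₀`-definable sets. -/
class Str.Arith (S : Str.{u}) : Prop where
  succ_ne_zero : ∀ x : S.carrier, S.succ x ≠ 0
  succ_inj : ∀ x y : S.carrier, S.succ x = S.succ y → x = y
  eq_succ : ∀ x : S.carrier, x ≠ 0 → ∃ y, x = S.succ y
  add_zero : ∀ x : S.carrier, x + 0 = x
  add_succ : ∀ x y : S.carrier, x + S.succ y = S.succ (x + y)
  mul_zero : ∀ x : S.carrier, x * 0 = 0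
  mul_succ : ∀ x y : S.carrier, x * S.succ y = x * y + x
  lt_iff : ∀ x y : S.carrier, x < y ↔ ∃ z, z + S.succ x = y
  induction : ∀ P : S.carrier → Prop, Delta0Rel (fun v : Fin 1 → S.carrier => P (v 0)) → P 0 →
    (∀ x, P x → P (S.succ x)) → ∀ x, P x

variable {S : Str.{u}}

namespace Str.Arith

variable [S.Arith]

theorem zero_add' (x : S.carrier) : 0 + x = x := by
  refine induction (fun x => 0 + x = x) (.eq (.add (.const _) (.var _)) (.var _)) (add_zero _)
    (fun x h => ?_) x
  rw [add_succ, h]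

theorem succ_add' (x y : S.carrier) : S.succ x + y = S.succ (x + y) := by
  refine induction (fun y => S.succ x + y = S.succ (x + y))
    (.eq (.add (.const _) (.var _)) (.succ (.add (.const _) (.var _)))) ?_ (fun y h => ?_) y
  · rw [add_zero, add_zero]
  · rw [add_succ, h, add_succ]

theorem add_comm' (x y : S.carrier) : x + y = y + x := by
  refine induction (fun y => x + y = y + x)
    (.eq (.add (.const _) (.var _)) (.add (.var _) (.const _))) ?_ (fun y h => ?_) y
  · rw [add_zero, zero_add']
  · rw [add_succ, h, succ_add']

theorem add_assoc' (x y z : S.carrier) : x + y + z = x + (y + z) := by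
  refine induction (fun z => x + y + z = x + (y + z))
    (.eq (.add (.const _) (.var _)) (.add (.const _) (.add (.const _) (.var _)))) ?_
    (fun z h => ?_) z
  · rw [add_zero, add_zero]
  · rw [add_succ, h, add_succ, add_succ]

theorem zero_mul' (x : S.carrier) : 0 * x = 0 := by
  refine induction (fun x => 0 * x = 0) (.eq (.mul (.const _) (.var _)) (.const _)) (mul_zero _)
    (fun x h => ?_) x
  rw [mul_succ, h, add_zero]

theorem succ_mul' (x y : S.carrier) : S.succ x * y = x * y + y := by
  refine induction (fun y => S.succ x * y = x * y + y)
    (.eq (.mul (.const _) (.var _)) (.add (.mul (.const _) (.var _)) (.var _))) ?_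
    (fun y h => ?_) y
  · rw [mul_zero, mul_zero, add_zero]
  · rw [mul_succ, h, mul_succ, add_succ, add_succ, add_assoc', add_assoc', add_comm' y]

theorem mul_comm' (x y : S.carrier) : x * y = y * x := by
  refine induction (fun y => x * y = y * x)
    (.eq (.mul (.const _) (.var _)) (.mul (.var _) (.const _))) ?_ (fun y h => ?_) y
  · rw [mul_zero, zero_mul']
  · rw [mul_succ, h, succ_mul']

theorem mul_add' (x y z : S.carrier) : x * (y + z) = x * y + x * z := by
  refine induction (fun z => x * (y + z) = x * y + x * z)
    (.eq (.mul (.const _) (.add (.const _) (.var _))) (.add (.const _) (.mul (.const _) (.var _))))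
    ?_ (fun z h => ?_) z
  · rw [mul_zero, add_zero, add_zero]
  · rw [add_succ, mul_succ, h, mul_succ, add_assoc']

theorem mul_assoc' (x y z : S.carrier) : x * y * z = x * (y * z) := by
  refine induction (fun z => x * y * z = x * (y * z))
    (.eq (.mul (.const _) (.var _)) (.mul (.const _) (.mul (.const _) (.var _)))) ?_
    (fun z h => ?_) z
  · rw [mul_zero, mul_zero, mul_zero]
  · rw [mul_succ, h, mul_succ, mul_add']

theorem succ_eq' (x : S.carrier) : S.succ x = x + 1 := by
  rw [show (1 : S.carrier) = S.succ 0 from rfl, add_succ, add_zero]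

theorem add_right_cancel' (x y z : S.carrier) (h : x + z = y + z) : x = y := by
  refine induction (fun z => x + z = y + z → x = y)
    (.imp (.eq (.add (.const _) (.var _)) (.add (.const _) (.var _))) (.eq (.const _) (.const _)))
    ?_ (fun z ih h => ih ?_) z h
  · rw [add_zero, add_zero]
    exact id
  · rw [add_succ, add_succ] at h
    exact succ_inj _ _ h

theorem eq_zero_of_add' (x y : S.carrier) (h : x + y = 0) : y = 0 := by
  by_contra hy
  obtain ⟨z, rfl⟩ := eq_succ y hy
  rw [add_succ] at h
  exact succ_ne_zero _ h

/-- The inductions behind this and the order instances below use only quantifier-free formulas.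
Afterwards `ring` and the ordered algebra lemmas apply inside the model. -/
instance : CommSemiring S.carrier where
  add_assoc := add_assoc'
  zero_add := zero_add'
  add_zero := add_zero
  add_comm := add_comm'
  nsmul := nsmulRec
  left_distrib := mul_add'
  right_distrib x y z := by rw [mul_comm', mul_add', mul_comm' z, mul_comm' z]
  zero_mul := zero_mul'
  mul_zero := mul_zero
  mul_assoc := mul_assoc'
  one_mul x := by
    rw [show (1 : S.carrier) = S.succ 0 from rfl, succ_mul', zero_mul', zero_add']
  mul_one x := by
    rw [show (1 : S.carrier) = S.succ 0 from rfl, mul_succ, mul_zero, zero_add']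
  mul_comm := mul_comm'

theorem lt_iff' (x y : S.carrier) : x < y ↔ ∃ z, z + 1 + x = y := by
  rw [lt_iff]
  refine exists_congr fun z => ?_
  rw [succ_eq', add_assoc, add_comm x]

instance : LE S.carrier := ⟨fun x y => x < y ∨ x = y⟩

theorem le_iff' (x y : S.carrier) : x ≤ y ↔ ∃ z, z + x = y := by
  change x < y ∨ x = y ↔ _
  rw [lt_iff']
  constructor
  · rintro (⟨z, h⟩ | h)
    · exact ⟨z + 1, h⟩
    · exact ⟨0, by rw [h, zero_add]⟩
  · rintro ⟨z, h⟩
    by_cases hz : z = 0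
    · right
      rw [← h, hz, zero_add]
    · left
      obtain ⟨w, rfl⟩ := eq_succ z hz
      exact ⟨w, by rw [← h, succ_eq']⟩

theorem le_antisymm' (x y : S.carrier) (hxy : x ≤ y) (hyx : y ≤ x) : x = y := by
  obtain ⟨z, rfl⟩ := (le_iff' _ _).1 hxy
  obtain ⟨w, h⟩ := (le_iff' _ _).1 hyx
  have h0 : w + z = 0 := add_right_cancel' _ _ x (by rw [add_assoc, h, zero_add])
  rw [eq_zero_of_add' _ _ h0, zero_add]

theorem lt_succ' (x : S.carrier) : x < S.succ x :=
  (lt_iff' _ _).2 ⟨0, by rw [succ_eq', zero_add, add_comm]⟩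

theorem le_total' (x y : S.carrier) : x ≤ y ∨ y ≤ x := by
  suffices x < y ∨ x = y ∨ y < x by
    rcases this with h | h | h
    exacts [.inl (.inl h), .inl (.inr h), .inr (.inl h)]
  refine induction (fun y => x < y ∨ x = y ∨ y < x)
    (.or (.lt (.const _) (.var _)) (.or (.eq (.const _) (.var _)) (.lt (.var _) (.const _)))) ?_
    (fun y h => ?_) y
  · by_cases hx : x = 0
    · exact .inr (.inl hx)
    · obtain ⟨z, rfl⟩ := eq_succ x hx
      exact .inr (.inr ((lt_iff' _ _).2 ⟨z, by rw [succ_eq', add_zero]⟩))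
  · rcases h with h | rfl | h
    · left
      obtain ⟨z, rfl⟩ := (lt_iff' _ _).1 h
      exact (lt_iff' _ _).2 ⟨z + 1, by rw [succ_eq']; ring⟩
    · exact .inl (lt_succ' x)
    · right
      obtain ⟨z, rfl⟩ := (lt_iff' _ _).1 h
      by_cases hz : z = 0
      · left
        rw [hz, succ_eq', zero_add, add_comm]
      · right
        obtain ⟨w, rfl⟩ := eq_succ z hz
        exact (lt_iff' _ _).2 ⟨w, by rw [succ_eq', succ_eq']; ring⟩

noncomputable instance : LinearOrder S.carrier where
  le_refl x := .inr rfl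
  le_trans x y z hxy hyz := by
    obtain ⟨a, rfl⟩ := (le_iff' _ _).1 hxy
    obtain ⟨b, rfl⟩ := (le_iff' _ _).1 hyz
    exact (le_iff' _ _).2 ⟨b + a, by rw [add_assoc]⟩
  lt_iff_le_not_ge x y := by
    constructor
    · intro h
      refine ⟨.inl h, fun h' => ?_⟩
      obtain rfl := le_antisymm' _ _ (.inl h) h'
      obtain ⟨z, hz⟩ := (lt_iff _ _).1 h
      have : S.succ z + x = 0 + x := by rw [succ_add', ← add_succ, hz, zero_add]
      exact succ_ne_zero _ (add_right_cancel' _ _ _ this)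
    · rintro ⟨h | rfl, h'⟩
      · exact h
      · exact absurd (.inr rfl) h'
  le_antisymm := le_antisymm'
  le_total := le_total'
  toDecidableLE := Classical.decRel _

instance : CanonicallyOrderedAdd S.carrier where
  exists_add_of_le {x y} h := by
    obtain ⟨z, rfl⟩ := (le_iff' _ _).1 h
    exact ⟨z, add_comm _ _⟩
  le_add_self x y := (le_iff' _ _).2 ⟨y, rfl⟩
  le_self_add x y := (le_iff' _ _).2 ⟨y, add_comm _ _⟩

theorem mul_lt_mul_left' (x : S.carrier) (hx : 0 < x) (y z : S.carrier) (h : y < z) :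
    x * y < x * z := by
  obtain ⟨w, rfl⟩ := (lt_iff' _ _).1 h
  obtain ⟨a, rfl⟩ := (lt_iff' _ _).1 hx
  exact (lt_iff' _ _).2 ⟨a * w + a + w, by ring⟩

instance : IsStrictOrderedRing S.carrier where
  add_le_add_left x y h z := by
    obtain ⟨w, rfl⟩ := (le_iff' _ _).1 h
    exact (le_iff' _ _).2 ⟨w, by ring⟩
  le_of_add_le_add_left x y z h := by
    obtain ⟨w, h⟩ := (le_iff' _ _).1 h
    exact (le_iff' _ _).2 ⟨w, add_right_cancel' _ _ x (by rw [add_comm z, ← h]; ring)⟩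
  zero_le_one := zero_le
  exists_pair_ne := ⟨1, 0, succ_ne_zero 0⟩
  mul_lt_mul_of_pos_left := fun x hx y z h => mul_lt_mul_left' x hx y z h
  mul_lt_mul_of_pos_right := fun x hx y z h => by
    simpa only [mul_comm _ x] using mul_lt_mul_left' x hx y z h

theorem lt_add_one_iff' {x y : S.carrier} : x < y + 1 ↔ x ≤ y := by
  rw [lt_iff', le_iff']
  refine exists_congr fun z => ?_
  rw [add_right_comm, add_left_inj]

theorem add_one_le_iff' {x y : S.carrier} : x + 1 ≤ y ↔ x < y := by
  rw [← lt_add_one_iff', add_lt_add_iff_right]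

theorem eq_zero_or_eq_add_one (x : S.carrier) : x = 0 ∨ ∃ y, x = y + 1 := by
  by_cases hx : x = 0
  · exact .inl hx
  · obtain ⟨y, rfl⟩ := eq_succ x hx
    exact .inr ⟨y, succ_eq' y⟩

theorem ind {P : S.carrier → Prop} (hP : Delta0Rel (fun v : Fin 1 → S.carrier => P (v 0)))
    (h0 : P 0) (hs : ∀ x, P x → P (x + 1)) (x : S.carrier) : P x :=
  induction P hP h0 (fun x h => succ_eq' x ▸ hs x h) x

end Str.Arith

open Str.Arith

theorem TermFun.one {n : ℕ} [S.Arith] : TermFun (fun _ : Fin n → S.carrier => 1) := .const _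

theorem Delta0Rel.le {n : ℕ} [S.Arith] {s t : (Fin n → S.carrier) → S.carrier} (hs : TermFun s)
    (ht : TermFun t) : Delta0Rel (fun v => s v ≤ t v) := by
  simpa only [not_lt] using (Delta0Rel.lt ht hs).not

theorem Delta0Rel.exists_least [S.Arith] {P : S.carrier → Prop}
    (hP : Delta0Rel (fun v : Fin 1 → S.carrier => P (v 0))) (hex : ∃ x, P x) :
    ∃ x, P x ∧ ∀ y < x, ¬ P y := by
  by_contra! h
  obtain ⟨x, hx⟩ := hex
  have : ∀ z : S.carrier, ∀ y, y < z → ¬ P y := by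
    -- Complete induction turned into plain induction: the bounded quantifier keeps the formula
    -- `Δ⁰₀`.
    refine ind (P := fun z => ∀ y, y < z → ¬ P y)
      (.ball (.var _) (.not (hP.subst_arg (fun _ => .inl 0)))) ?_ ?_
    · intro y hy
      exact absurd hy not_lt_zero
    · intro z hz y hy hPy
      obtain ⟨w, hw, hPw⟩ := h y hPy
      exact hz w (hw.trans_le (lt_add_one_iff'.1 hy)) hPw
  exact this (x + 1) x (lt_add_one_iff'.2 le_rfl) hx

theorem exists_div [S.Arith] (s : S.carrier) {d : S.carrier} (hd : 0 < d) :
    ∃ q r, s = q * d + r ∧ r < d := by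
  suffices ∃ q, q < s + 1 ∧ ∃ r, r < d ∧ s = q * d + r by
    obtain ⟨q, -, r, hr, h⟩ := this
    exact ⟨q, r, h, hr⟩
  refine ind (P := fun s => ∃ q, q < s + 1 ∧ ∃ r, r < d ∧ s = q * d + r)
    (.bex (.add (.var _) .one) (.bex (.const _)
      (.eq (.var _) (.add (.mul (.var _) (.const _)) (.var _))))) ?_ ?_ s
  · exact ⟨0, by simp, 0, hd, by simp⟩
  · rintro s ⟨q, hq, r, hr, h⟩
    rcases (add_one_le_iff'.2 hr).lt_or_eq with h1 | h1
    · exact ⟨q, hq.trans (lt_add_one_iff'.2 le_rfl), r + 1, h1, by rw [h, add_assoc]⟩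
    · refine ⟨q + 1, by simpa using hq, 0, hd, ?_⟩
      rw [h, ← h1]
      ring

theorem rem_unique [S.Arith] {d q r q' r' : S.carrier} (h : q * d + r = q' * d + r') (hr : r < d)
    (hr' : r' < d) : r = r' := by
  have key : ∀ {q r q' r' : S.carrier}, q * d + r = q' * d + r' → r < d → ¬ q < q' := by
    intro q r q' r' h hr hq
    obtain ⟨z, rfl⟩ := (lt_iff' _ _).1 hq
    have : q * d + r < q * d + d := by gcongr
    rw [h, show (z + 1 + q) * d + r' = q * d + d + (z * d + r') by ring] at this
    exact absurd this (not_lt.2 le_self_add)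
  obtain rfl := le_antisymm (not_lt.1 (key h.symm hr')) (not_lt.1 (key h hr))
  exact add_left_cancel h

end

section

variable {S : Str.{u}} [S.Arith]

open Str.Arith

/-! ### Substitution into `Δ⁰₀`-definable relations -/

/-- The value of a term can be named by a quantifier bounded by that term plus one, so no syntactic
substitution is needed. -/
theorem Delta0Rel.subst {n : ℕ} {Q : S.carrier → (Fin n → S.carrier) → Prop}
    {t : (Fin n → S.carrier) → S.carrier} (ht : TermFun t)
    (hQ : Delta0Rel (fun w : Fin (n + 1) → S.carrier => Q (w 0) (fun i => w i.succ))) :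
    Delta0Rel (fun v => Q (t v) v) := by
  have : Delta0Rel (fun v => ∃ x, x < t v + 1 ∧ x = t v ∧ Q x v) :=
    .bex (.add ht .one) (.and (.eq (.var _) ht.tail) hQ)
  convert this using 2 with v
  constructor
  · exact fun h => ⟨t v, lt_add_one_iff'.2 le_rfl, rfl, h⟩
  · rintro ⟨x, -, rfl, h⟩
    exact h

theorem Delta0Rel.app₂ {n : ℕ} {P : S.carrier → S.carrier → Prop}
    {s t : (Fin n → S.carrier) → S.carrier}
    (hP : Delta0Rel (fun v : Fin 2 → S.carrier => P (v 0) (v 1)))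
    (hs : TermFun s) (ht : TermFun t) : Delta0Rel (fun v => P (s v) (t v)) := by
  refine subst (Q := fun x v => P x (t v)) hs ?_
  refine subst (Q := fun y w => P (w 0) y) ht.tail ?_
  exact hP.subst_arg ![.inl 1, .inl 0]

/-- Here `f` need not be a term: its graph is `Δ⁰₀` and the constant `b` bounds the quantifier that
names its value. -/
theorem Delta0Rel.substFun {n : ℕ} {Q : S.carrier → (Fin n → S.carrier) → Prop}
    {f : S.carrier → S.carrier} {b : S.carrier} {t : (Fin n → S.carrier) → S.carrier}
    (hf : Delta0Rel (fun v : Fin 2 → S.carrier => f (v 0) = v 1)) (hb : ∀ x, f x ≤ b)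
    (ht : TermFun t)
    (hQ : Delta0Rel (fun w : Fin (n + 1) → S.carrier => Q (w 0) (fun i => w i.succ))) :
    Delta0Rel (fun v => Q (f (t v)) v) := by
  have : Delta0Rel (fun v => ∃ x, x < b + 1 ∧ f (t v) = x ∧ Q x v) :=
    .bex (.const _) (.and (hf.app₂ (P := fun x y => f x = y) ht.tail (.var _)) hQ)
  convert this using 2 with v
  constructor
  · exact fun h => ⟨f (t v), lt_add_one_iff'.2 (hb _), rfl, h⟩
  · rintro ⟨x, -, rfl, h⟩
    exact h

/-! ### Binary digits -/

/-- A parametrised sequence of powers of two up to `2 ^ n`: `W i p` says `p = 2 ^ i`. -/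
structure PowSeq (n B : S.carrier) (W : S.carrier → S.carrier → Prop) : Prop where
  delta0 : Delta0Rel (fun v : Fin 2 → S.carrier => W (v 0) (v 1))
  lt_bound : ∀ {i p}, W i p → p < B
  unique : ∀ {i p p'}, W i p → W i p' → p = p'
  zero : W 0 1
  step : ∀ {i}, i < n → ∃ p, W i p ∧ W (i + 1) (p + p)

/-- `r` is the value at `i` of the sequence coded by `a` and `c` by Gödel's `β` function. -/
def Beta (a c i r : S.carrier) : Prop :=
  r < (i + 1) * c + 1 ∧ ∃ q, a = q * ((i + 1) * c + 1) + r

/-- The quotient in `Beta` never exceeds `a`, since the divisor is at least `1`; bounding it makes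
the graph `Δ⁰₀`. Uniqueness of powers is uniqueness of remainders, and the largest divisor, at index
`n`, bounds them all. -/
theorem exists_powSeq {n a c : S.carrier} (h0 : Beta a c 0 1)
    (hs : ∀ i < n, ∃ r, Beta a c i r ∧ Beta a c (i + 1) (r + r)) :
    ∃ B W, PowSeq (S := S) n B W := by
  refine ⟨(n + 1) * c + 1, fun i p => i ≤ n ∧ p < (i + 1) * c + 1 ∧
    ∃ q, q < a + 1 ∧ a = q * ((i + 1) * c + 1) + p, ?_, ?_, ?_, ?_, ?_⟩
  · have hd {k : ℕ} {t : (Fin k → S.carrier) → S.carrier} (ht : TermFun t) :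
        TermFun (fun v => (t v + 1) * c + 1) := .add (.mul (.add ht .one) (.const _)) .one
    exact .and (.le (.var _) (.const _)) (.and (.lt (.var _) (hd (.var _)))
      (.bex (.const _) (.eq (.const _) (.add (.mul (.var _) (hd (.var _))) (.var _)))))
  · rintro i p ⟨hi, hp, -⟩
    refine hp.trans_le ?_
    gcongr
  · rintro i p p' ⟨-, hp, q, -, hq⟩ ⟨-, hp', q', -, hq'⟩
    exact rem_unique (hq.symm.trans hq') hp hp'
  all_goals
    have bound {i r : S.carrier} (h : Beta a c i r) : r < (i + 1) * c + 1 ∧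
        ∃ q, q < a + 1 ∧ a = q * ((i + 1) * c + 1) + r := by
      obtain ⟨hr, q, hq⟩ := h
      refine ⟨hr, q, ?_, hq⟩
      rw [lt_add_one_iff', hq, mul_add, mul_one, add_assoc, add_left_comm]
      exact le_self_add
  · exact ⟨zero_le, bound h0⟩
  · intro i hi
    obtain ⟨r, hr, hr'⟩ := hs i hi
    exact ⟨r, ⟨hi.le, bound hr⟩, add_one_le_iff'.2 hi, bound hr'⟩

namespace PowSeq

variable {n B : S.carrier} {W : S.carrier → S.carrier → Prop}

theorem exists_multiple (h : PowSeq n B W) {i d : S.carrier} (hi : W i d) (hd : 0 < d)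
    (m : S.carrier) : m ≤ n → i ≤ m → ∃ p, W m p ∧ 0 < p ∧ ∃ k, p = k * d := by
  -- The bounds on `p` and `k` are there only to make the induction formula `Δ⁰₀`.
  have key : ∀ m, m ≤ n → i ≤ m →
      ∃ p, p < B ∧ W m p ∧ 0 < p ∧ ∃ k, k < p + 1 ∧ p = k * d := by
    refine ind (.imp (.le (.var _) (.const _)) (.imp (.le (.const _) (.var _)) (.bex (.const _)
      (.and (h.delta0.app₂ (.var _) (.var _)) (.and (.lt (.const _) (.var _))
        (.bex (.add (.var _) .one) (.eq (.var _) (.mul (.var _) (.const _))))))))) ?_ ?_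
    · intro _ h0
      obtain rfl := nonpos_iff_eq_zero.1 h0
      exact ⟨d, h.lt_bound hi, hi, hd, 1, by simpa using hd, (one_mul d).symm⟩
    · intro m ih hm him
      rcases him.eq_or_lt with rfl | him
      · exact ⟨d, h.lt_bound hi, hi, hd, 1, by simpa using hd, (one_mul d).symm⟩
      · have hmn := add_one_le_iff'.1 hm
        obtain ⟨p, -, hp, hp0, k, hk, hpk⟩ := ih hmn.le (lt_add_one_iff'.1 him)
        obtain ⟨p', hp', hpp⟩ := h.step hmn
        obtain rfl := h.unique hp hp'
        refine ⟨p + p, h.lt_bound hpp, hpp, add_pos hp0 hp0, k + k, ?_, by rw [add_mul, ← hpk]⟩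
        rw [lt_add_one_iff'] at hk ⊢
        exact add_le_add hk hk
  intro hm him
  obtain ⟨p, -, hp, hp0, k, -, hpk⟩ := key m hm him
  exact ⟨p, hp, hp0, k, hpk⟩

theorem exists_pos (h : PowSeq n B W) {m : S.carrier} (hm : m ≤ n) : ∃ p, W m p ∧ 0 < p := by
  obtain ⟨p, hp, hp0, -⟩ := h.exists_multiple h.zero zero_lt_one m hm zero_le
  exact ⟨p, hp, hp0⟩

/-- The digit of `s` with weight `2 ^ i` is `1`. -/
def Bit (B : S.carrier) (W : S.carrier → S.carrier → Prop) (i s : S.carrier) : Prop :=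
  ∃ p, p < B ∧ W i p ∧ ∃ q, q < s + 1 ∧ ∃ r, r < p + p ∧ s = q * (p + p) + r ∧ p ≤ r

theorem delta0_bit (h : PowSeq n B W) :
    Delta0Rel (fun v : Fin 2 → S.carrier => Bit B W (v 0) (v 1)) :=
  .bex (.const _) (.and (h.delta0.app₂ (.var _) (.var _)) (.bex (.add (.var _) .one)
    (.bex (.add (.var _) (.var _)) (.and (.eq (.var _) (.add (.mul (.var _)
      (.add (.var _) (.var _))) (.var _))) (.le (.var _) (.var _))))))

/-- By uniqueness of remainders, any division of `s` by `2 ^ (i + 1)` decides the digit, with no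
bound on the quotient to check. -/
theorem bit_iff (h : PowSeq n B W) {i p s q r : S.carrier} (hp : W i p)
    (hs : s = q * (p + p) + r) (hr : r < p + p) : Bit B W i s ↔ p ≤ r := by
  constructor
  · rintro ⟨p', -, hp', q', -, r', hr', hs', hpr⟩
    obtain rfl := h.unique hp hp'
    rwa [rem_unique (hs.symm.trans hs') hr hr']
  · intro hpr
    refine ⟨p, h.lt_bound hp, hp, q, ?_, r, hr, hs, hpr⟩
    have : 1 ≤ p + p := by
      have := add_one_le_iff'.2 ((zero_le (a := r)).trans_lt hr)
      rwa [zero_add] at this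
    rw [lt_add_one_iff', hs]
    exact (le_mul_of_one_le_right zero_le this).trans le_self_add

/-- Prescribing a digit while keeping all lower ones. -/
theorem exists_bit (h : PowSeq n B W) {l : S.carrier} (hl : W n l) (s : S.carrier) {m : S.carrier}
    (hm : m < n) (c : Prop) :
    ∃ s' < l, (∀ i < m, Bit B W i s' ↔ Bit B W i s) ∧ (Bit B W m s' ↔ c) := by
  obtain ⟨p, hp, hp0⟩ := h.exists_pos hm.le
  obtain ⟨p', hp', hpp⟩ := h.step hm
  obtain rfl := h.unique hp hp'
  obtain ⟨l', hl', hl0, k, hlk⟩ :=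
    h.exists_multiple hpp (add_pos hp0 hp0) n le_rfl (add_one_le_iff'.2 hm)
  obtain rfl := h.unique hl hl'
  -- `l` is a nonzero multiple of `2 ^ (m + 1)`, so every number with digits only up to position `m`
  -- lies below `l`.
  have hpl : p + p ≤ l := by
    rcases eq_zero_or_eq_add_one k with rfl | ⟨k, rfl⟩
    · rw [hlk, zero_mul] at hl0
      exact absurd hl0 (lt_irrefl _)
    · rw [hlk, add_mul, one_mul]
      exact le_add_self
  obtain ⟨q, r, hs, hr⟩ := exists_div s hp0
  -- For `i < m` the weight `p = 2 ^ m` is a multiple of `2 ^ (i + 1)`, so adding multiples of `p`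
  -- does not affect digit `i`.
  have low : ∀ e, ∀ i < m, Bit B W i (e * p + r) ↔ Bit B W i r := by
    intro e i hi
    obtain ⟨d, hd, hd0⟩ := h.exists_pos (hi.trans hm).le
    obtain ⟨d', hd', hdd⟩ := h.step (hi.trans hm)
    obtain rfl := h.unique hd hd'
    obtain ⟨p', hp', -, k, hpk⟩ :=
      h.exists_multiple hdd (add_pos hd0 hd0) m hm.le (add_one_le_iff'.2 hi)
    obtain rfl := h.unique hp hp'
    obtain ⟨q', r', hr', hlt⟩ := exists_div r (add_pos hd0 hd0)
    rw [h.bit_iff hd hr' hlt, h.bit_iff (q := e * k + q') hd ?_ hlt]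
    rw [add_mul, mul_assoc, ← hpk, add_assoc, ← hr']
  -- The new number is `2 ^ m + r` or `r`, where `r` is `s` modulo `2 ^ m`: all digits above
  -- position `m` are erased.
  by_cases hc : c
  · refine ⟨p + r, (add_lt_add_right hr p).trans_le hpl, fun i hi => ?_, ?_⟩
    · rw [hs, low q i hi, ← low 1 i hi, one_mul]
    · rw [h.bit_iff (q := 0) hp (by rw [zero_mul, zero_add]) (add_lt_add_right hr p)]
      exact iff_of_true le_self_add hc
  · refine ⟨r, (hr.trans_le le_self_add).trans_le hpl, fun i hi => ?_, ?_⟩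
    · rw [hs, low q i hi]
    · rw [h.bit_iff (q := 0) hp (by rw [zero_mul, zero_add]) (hr.trans_le le_self_add)]
      exact iff_of_false (not_le.2 hr) hc

end PowSeq

/-! ### A bounded nondecreasing function without largest value -/

/-- A failure of `Σ⁰₁` induction yields a `Δ⁰₀`-definable nondecreasing bounded function that has
no largest value. -/
theorem exists_bounded_growing {P : S.carrier → S.carrier → Prop}
    (hP : Delta0Rel (fun v : Fin 2 → S.carrier => P (v 0) (v 1))) (h0 : ∃ y, P y 0)
    (hs : ∀ x, (∃ y, P y x) → ∃ y, P y (x + 1)) {b : S.carrier} (hb : ∀ y, ¬ P y b) :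
    ∃ f : S.carrier → S.carrier, Delta0Rel (fun v : Fin 2 → S.carrier => f (v 0) = v 1) ∧
      (∀ x, f x ≤ b) ∧ Monotone f ∧ ∀ x, ∃ y, f x < f y := by
  have least : ∀ w, ∃ x, (∀ y < w, ¬ P y x) ∧ ∀ u < x, ¬ ∀ y < w, ¬ P y u := fun w =>
    Delta0Rel.exists_least (.ball (.const _) (.not (hP.app₂ (.var _) (.var _))))
      ⟨b, fun y _ => hb y⟩
  choose f hf hf' using least
  have low : ∀ {w u}, (∀ y < w, ¬ P y u) → f w ≤ u := fun h => not_lt.1 fun hu => hf' _ _ hu h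
  refine ⟨f, ?_, fun x => low fun y _ => hb y, fun x y hxy => low fun z hz =>
    hf y z (hz.trans_le hxy), fun w => ?_⟩
  · have : Delta0Rel (fun v : Fin 2 → S.carrier =>
        (∀ y, y < v 0 → ¬ P y (v 1)) ∧ ∀ u, u < v 1 → ¬ ∀ y, y < v 0 → ¬ P y u) :=
      .and (.ball (.var _) (.not (hP.app₂ (.var _) (.var _))))
        (.ball (.var _) (.not (.ball (.var _) (.not (hP.app₂ (.var _) (.var _))))))
    convert this using 2 with v
    constructor
    · rintro h
      rw [← h]
      exact ⟨hf _, hf' _⟩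
    · rintro ⟨h₁, h₂⟩
      exact le_antisymm (low h₁) (not_lt.1 fun h => h₂ _ h (hf _))
  -- Everything below `f w` already has a witness, so progressiveness gives one for `f w`; once that
  -- witness is passed, the value must change.
  · obtain ⟨y, hy⟩ : ∃ y, P y (f w) := by
      rcases eq_zero_or_eq_add_one (f w) with h | ⟨u, h⟩
      · rwa [h]
      · rw [h]
        refine hs u ?_
        have := hf' w u (h ▸ lt_add_one_iff'.2 le_rfl)
        push Not at this
        obtain ⟨y, -, hy⟩ := this
        exact ⟨y, hy⟩
    refine ⟨max w (y + 1), lt_of_le_of_ne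
      (low fun z hz => hf _ z (hz.trans_le (le_max_left _ _))) fun h => ?_⟩
    rw [h] at hy
    exact hf _ y ((lt_add_one_iff'.2 le_rfl).trans_le (le_max_right _ _)) hy

/-! ### Pairing -/

/-- `(a + b)² + a` stays below `(a + b + 1)²`, so a code determines the sum of its components. -/
theorem pair_lt_of_lt {a b a' b' : S.carrier} (h : a + b < a' + b') :
    (a + b) * (a + b) + a < (a' + b') * (a' + b') + a' := by
  have h1 : a + b + 1 ≤ a' + b' := add_one_le_iff'.2 h
  have h2 : (a + b) * (a + b) + a + (a + b + b + 1) ≤ (a' + b') * (a' + b') :=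
    le_of_eq_of_le (by ring) (mul_le_mul' h1 h1)
  refine lt_of_lt_of_le ?_ (h2.trans le_self_add)
  rw [← add_assoc]
  exact lt_add_one_iff'.2 le_self_add

theorem pair_inj {a b a' b' : S.carrier}
    (h : (a + b) * (a + b) + a = (a' + b') * (a' + b') + a') : a = a' ∧ b = b' := by
  have hab : a + b = a' + b' := le_antisymm (not_lt.1 fun hlt => (pair_lt_of_lt hlt).ne' h)
    (not_lt.1 fun hlt => (pair_lt_of_lt hlt).ne h)
  rw [hab] at h
  obtain rfl := add_left_cancel h
  exact ⟨rfl, add_left_cancel hab⟩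

theorem le_pair_left (a b : S.carrier) : a ≤ (a + b) * (a + b) + a := le_add_self

theorem le_pair_right (a b : S.carrier) : b ≤ (a + b) * (a + b) + a := by
  refine le_trans ?_ le_self_add
  rcases eq_zero_or_eq_add_one (a + b) with h | ⟨c, h⟩
  · rw [nonpos_iff_eq_zero.1 ((le_add_self : b ≤ a + b).trans h.le)]
    exact zero_le
  · calc b ≤ a + b := le_add_self
      _ ≤ (a + b) * (a + b) := le_mul_of_one_le_right zero_le (h ▸ le_add_self)

end

section

variable {S : Str.{u}}

open Str.Arith

/-! ### Cohesive sets against failures of induction -/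

/-- `f x < f y` are values of `f` on `H` with no value of `f` on `H` below `y` in between. -/
def Consec [S.Arith] (H : Set S.carrier) (f : S.carrier → S.carrier) (x y : S.carrier) : Prop :=
  x ∈ H ∧ y ∈ H ∧ f x < f y ∧ ∀ u, u < y → u ∈ H → ¬ (f x < f u ∧ f u < f y)

section Alternating

variable [S.Arith] {H : Set S.carrier} {f : S.carrier → S.carrier} {b n B l : S.carrier}
  {W : S.carrier → S.carrier → Prop}

theorem delta0_lt_fun (hf : Delta0Rel (fun v : Fin 2 → S.carrier => f (v 0) = v 1))
    (hb : ∀ x, f x ≤ b) : Delta0Rel (fun v : Fin 2 → S.carrier => f (v 0) < f (v 1)) :=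
  .substFun (Q := fun z v => z < f (v 1)) hf hb (.var _)
    (.substFun (Q := fun z w => w 0 < z) hf hb (.var 2) (.lt (.var _) (.var _)))

theorem delta0_consec (hH : H ∈ S.sets)
    (hf : Delta0Rel (fun v : Fin 2 → S.carrier => f (v 0) = v 1)) (hb : ∀ x, f x ≤ b) :
    Delta0Rel (fun v : Fin 2 → S.carrier => Consec H f (v 0) (v 1)) := by
  have hlt := delta0_lt_fun hf hb
  exact .and (.mem (.var _) hH) (.and (.mem (.var _) hH) (.and hlt (.ball (.var _)
    (.imp (.mem (.var _) hH) (.not (.and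
      (hlt.app₂ (P := fun x y => f x < f y) (.var _) (.var _))
      (hlt.app₂ (P := fun x y => f x < f y) (.var _) (.var _))))))))

theorem delta0_bit_fun (hf : Delta0Rel (fun v : Fin 2 → S.carrier => f (v 0) = v 1))
    (hb : ∀ x, f x ≤ b) (hW : PowSeq n B W) :
    Delta0Rel (fun v : Fin 2 → S.carrier => PowSeq.Bit B W (f (v 0)) (v 1)) :=
  .substFun (Q := fun z v => PowSeq.Bit B W z (v 1)) hf hb (.var _)
    (hW.delta0_bit.app₂ (.var _) (.var _))

/-- Induction on `z`. If `f z` is already a value of `f` on `H` below `z`, the old `s` still works.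
If not, `f z` exceeds all those values, and it is enough to reset digit `f z` to the opposite of its
predecessor's digit. -/
theorem exists_alternating_below (hH : H ∈ S.sets)
    (hf : Delta0Rel (fun v : Fin 2 → S.carrier => f (v 0) = v 1)) (hb : ∀ x, f x ≤ b)
    (hmono : Monotone f) (hW : PowSeq n B W) (hl : W n l) (hbn : b < n) (z : S.carrier) :
    ∃ s, s < l ∧ ∀ y, y < z → ∀ x, x < y → Consec H f x y →
      (PowSeq.Bit B W (f x) s ↔ ¬ PowSeq.Bit B W (f y) s) := by
  have hbit := delta0_bit_fun hf hb hW
  refine ind (P := fun z => ∃ s, s < l ∧ ∀ y, y < z → ∀ x, x < y → Consec H f x y →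
      (PowSeq.Bit B W (f x) s ↔ ¬ PowSeq.Bit B W (f y) s)) ?_ ?_ ?_ z
  · exact .bex (.const _) (.ball (.var _) (.ball (.var _)
      (.imp ((delta0_consec hH hf hb).app₂ (.var _) (.var _))
        (.iff (hbit.app₂ (P := fun x s => PowSeq.Bit B W (f x) s) (.var _) (.var _))
          (.not (hbit.app₂ (P := fun x s => PowSeq.Bit B W (f x) s) (.var _) (.var _)))))))
  -- Any number below `l` will do here; the prescribed digit is irrelevant.
  · obtain ⟨s, hs, -⟩ := hW.exists_bit hl 0 (zero_le.trans_lt hbn) True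
    exact ⟨s, hs, fun y hy => absurd hy not_lt_zero⟩
  · rintro z ⟨s, hsl, hs⟩
    by_cases hz : ∃ u, u < z ∧ u ∈ H ∧ f u = f z
    · obtain ⟨u, huz, huH, hu⟩ := hz
      refine ⟨s, hsl, fun y hy x hxy hc => ?_⟩
      rcases (lt_add_one_iff'.1 hy).lt_or_eq with hy | rfl
      · exact hs y hy x hxy hc
      · rw [← hu]
        refine hs u huz x ?_ ⟨hc.1, huH, hu ▸ hc.2.2.1, fun v hv hvH => ?_⟩
        · exact hmono.reflect_lt (hu ▸ hc.2.2.1)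
        · rw [hu]
          exact hc.2.2.2 v (hv.trans huz) hvH
    · have hlt : ∀ u < z, u ∈ H → f u < f z := fun u hu huH =>
        lt_of_le_of_ne (hmono hu.le) fun h => hz ⟨u, hu, huH, h⟩
      obtain ⟨s', hs', hlow, htop⟩ := hW.exists_bit hl s ((hb z).trans_lt hbn)
        (∃ x, x < z ∧ Consec H f x z ∧ ¬ PowSeq.Bit B W (f x) s)
      refine ⟨s', hs', fun y hy x hxy hc => ?_⟩
      rcases (lt_add_one_iff'.1 hy).lt_or_eq with hy | rfl
      · have hyz := hlt y hy hc.2.1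
        rw [hlow _ (hc.2.2.1.trans hyz), hlow _ hyz]
        exact hs y hy x hxy hc
      · rw [hlow _ hc.2.2.1, htop]
        constructor
        · rintro hx ⟨x', hxy', hc', hx'⟩
          -- Two predecessors of the same element have equal `f`-value, since otherwise the larger
          -- value would lie strictly between.
          rcases lt_trichotomy (f x) (f x') with h | h | h
          · exact hc.2.2.2 x' hxy' hc'.1 ⟨h, hc'.2.2.1⟩
          · exact hx' (h ▸ hx)
          · exact hc'.2.2.2 x hxy hc.1 ⟨h, hc.2.2.1⟩
        · intro h
          by_contra hx
          exact h ⟨x, hxy, hc, hx⟩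

end Alternating

/-- Models of `RCA₀* + fin-COH`, axiomatised semantically. -/
structure Str.IsCohModel (S : Str.{u}) [S.Arith] : Prop where
  collection : ∀ P : S.carrier → S.carrier → Prop,
    Delta0Rel (fun v : Fin 2 → S.carrier => P (v 0) (v 1)) → ∀ a, (∀ x < a, ∃ y, P y x) →
      ∃ c, ∀ x < a, ∃ y < c, P y x
  comprehension : ∀ P : S.carrier → Prop, Delta0Rel (fun v : Fin 1 → S.carrier => P (v 0)) →
    {x | P x} ∈ S.sets
  exp : ∀ n : S.carrier, ∃ a c y, Beta a c 0 1 ∧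
    (∀ i < n, ∃ r, Beta a c i r ∧ Beta a c (i + 1) (r + r)) ∧ Beta a c n y
  coh : ∀ l : S.carrier, ∀ R ∈ S.sets, ∃ H ∈ S.sets, (∀ b, ∃ a, a ∈ H ∧ b < a) ∧ ∀ k < l,
    (∃ b, ∀ x, b < x → x ∈ H → (k + x) * (k + x) + k ∈ R) ∨
    (∃ b, ∀ x, b < x → x ∈ H → (k + x) * (k + x) + k ∉ R)

theorem Str.IsCohModel.sigma1_induction [S.Arith] (hS : S.IsCohModel)
    {P : S.carrier → S.carrier → Prop}
    (hP : Delta0Rel (fun v : Fin 2 → S.carrier => P (v 0) (v 1))) (h0 : ∃ y, P y 0)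
    (hs : ∀ x, (∃ y, P y x) → ∃ y, P y (x + 1)) (b : S.carrier) : ∃ y, P y b := by
  by_contra! hPb
  obtain ⟨f, hf, hb, hmono, hgrow⟩ := exists_bounded_growing hP h0 hs hPb
  -- Values of `f` run up to and including `b`, so `b + 1` digit positions are needed.
  obtain ⟨a, c, y, hβ0, hβs, -⟩ := hS.exp (b + 1)
  obtain ⟨B, W, hW⟩ := exists_powSeq hβ0 hβs
  obtain ⟨l, hl, -⟩ := hW.exists_pos le_rfl
  have hbn : b < b + 1 := lt_add_one_iff'.2 le_rfl
  have hbit := delta0_bit_fun hf hb hW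
  have hR : {z | ∃ k, k < z + 1 ∧ ∃ x, x < z + 1 ∧
      z = (k + x) * (k + x) + k ∧ PowSeq.Bit B W (f x) k} ∈ S.sets := by
    refine hS.comprehension _ (.bex (.add (.var _) .one) (.bex (.add (.var _) .one)
      (.and (.eq (.var _) (.add (.mul (.add (.var _) (.var _)) (.add (.var _) (.var _)))
        (.var _))) (hbit.app₂ (P := fun x s => PowSeq.Bit B W (f x) s) (.var _) (.var _)))))
  obtain ⟨H, hH, hinf, hcoh⟩ := hS.coh l _ hR
  have hpair : ∀ k x, ((k + x) * (k + x) + k ∈ {z | ∃ k, k < z + 1 ∧ ∃ x, x < z + 1 ∧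
      z = (k + x) * (k + x) + k ∧ PowSeq.Bit B W (f x) k}) ↔ PowSeq.Bit B W (f x) k := by
    intro k x
    constructor
    · rintro ⟨k', -, x', -, h, hk⟩
      obtain ⟨rfl, rfl⟩ := pair_inj h
      exact hk
    · intro h
      exact ⟨k, lt_add_one_iff'.2 (le_pair_left _ _), x, lt_add_one_iff'.2 (le_pair_right _ _),
        rfl, h⟩
  simp only [hpair] at hcoh
  obtain ⟨s, hsl, hs⟩ : ∃ s, s < l ∧ ∀ y x, x < y → Consec H f x y →
      (PowSeq.Bit B W (f x) s ↔ ¬ PowSeq.Bit B W (f y) s) := by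
    -- Collection bounds the counterexamples of all `s < l` by one `z`, contradicting the `s` that
    -- alternates below `z`.
    by_contra! hno
    obtain ⟨z, hz⟩ := hS.collection (fun y s => ∃ x, x < y ∧ Consec H f x y ∧
        ¬ (PowSeq.Bit B W (f x) s ↔ ¬ PowSeq.Bit B W (f y) s))
      (.bex (.var _) (.and ((delta0_consec hH hf hb).app₂ (.var _) (.var _)) (.not
        (.iff (hbit.app₂ (P := fun x s => PowSeq.Bit B W (f x) s) (.var _) (.var _))
          (.not (hbit.app₂ (P := fun x s => PowSeq.Bit B W (f x) s) (.var _) (.var _)))))))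
      l (fun s hsl => by
        obtain ⟨y, x, hxy, hc, h⟩ := hno s hsl
        exact ⟨y, x, hxy, hc, by tauto⟩)
    obtain ⟨s, hsl, hs⟩ := exists_alternating_below hH hf hb hmono hW hl hbn z
    obtain ⟨y, hy, x, hxy, hc, h⟩ := hz s hsl
    exact h (hs y hy x hxy hc)
  have hnext : ∀ t, ∃ x y, t < x ∧ t < y ∧ x ∈ H ∧ y ∈ H ∧
      (PowSeq.Bit B W (f x) s ↔ ¬ PowSeq.Bit B W (f y) s) := by
    intro t
    obtain ⟨x, hxH, htx⟩ := hinf t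
    obtain ⟨w, hw⟩ := hgrow x
    obtain ⟨y₀, hy₀H, hwy⟩ := hinf w
    -- The least `y` in `H` with `f x < f y` is consecutive to `x`: an intermediate value would
    -- occur earlier and contradict minimality.
    obtain ⟨y, ⟨hyH, hxy⟩, hleast⟩ := Delta0Rel.exists_least
      (P := fun y => y ∈ H ∧ f x < f y) (.and (.mem (.var _) hH)
        ((delta0_lt_fun hf hb).app₂ (P := fun x y => f x < f y) (.const _) (.var _)))
      ⟨y₀, hy₀H, hw.trans_le (hmono hwy.le)⟩
    have hlt := hmono.reflect_lt hxy
    exact ⟨x, y, htx, htx.trans hlt, hxH, hyH, hs y x hlt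
      ⟨hxH, hyH, hxy, fun u hu huH h => hleast u hu ⟨huH, h.1⟩⟩⟩
  rcases hcoh s hsl with ⟨t, ht⟩ | ⟨t, ht⟩
  · obtain ⟨x, y, hx, hy, hxH, hyH, h⟩ := hnext t
    exact h.1 (ht x hx hxH) (ht y hy hyH)
  · obtain ⟨x, y, hx, hy, hxH, hyH, h⟩ := hnext t
    exact ht x hx hxH (h.2 (ht y hy hyH))

/-! ### `Σ⁰₁` formulas -/

theorem Delta0Rel.of_formula {m n k : ℕ} {φ : Fm m n} (hφ : φ.IsDelta0)
    {A : Fin m → Set S.carrier} (hA : ∀ i, A i ∈ S.sets) (τ : Fin n → Fin k ⊕ S.carrier) :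
    Delta0Rel (fun v => φ.Sat S A (env τ v)) :=
  ⟨m, n, A, τ, φ, hA, hφ, fun _ => Iff.rfl⟩

theorem Fm.IsSigma1.exists_delta0Rel [S.Arith] {m n : ℕ} {φ : Fm m n} (hφ : φ.IsSigma1)
    {A : Fin m → Set S.carrier} (hA : ∀ i, A i ∈ S.sets) :
    ∃ Q : S.carrier → (Fin n → S.carrier) → Prop,
      Delta0Rel (fun w : Fin (n + 1) → S.carrier => Q (w 0) (fun i => w i.succ)) ∧
      ∀ v, φ.Sat S A v ↔ ∃ y, Q y v := by
  induction hφ with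
  | delta0 hφ =>
    exact ⟨fun _ v => Fm.Sat S _ A v, .of_formula hφ hA (fun i => .inl i.succ),
      fun v => ⟨fun h => ⟨0, h⟩, fun ⟨_, h⟩ => h⟩⟩
  | ex _ ih =>
    obtain ⟨Q, hQ, h⟩ := ih
    -- Two unbounded existential quantifiers merge into one by quantifying over a common strict
    -- bound for both witnesses.
    refine ⟨fun z v => ∃ x, x < z ∧ ∃ y, y < z ∧ Q y (Matrix.vecCons x v), ?_, fun v => ?_⟩
    · refine .bex (.var _) (.bex (.var _) ?_)
      convert hQ.subst_arg (k := _ + 3) (Matrix.vecCons (.inl 0)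
        (Matrix.vecCons (.inl 1) (fun i => .inl i.succ.succ.succ))) using 3 with w
      · rfl
      · funext i
        refine Fin.cases ?_ (fun i => ?_) i <;> simp [env]
    · change (∃ x, _) ↔ _
      simp only [h]
      constructor
      · rintro ⟨x, y, hy⟩
        exact ⟨max x y + 1, x, lt_add_one_iff'.2 (le_max_left _ _), y,
          lt_add_one_iff'.2 (le_max_right _ _), hy⟩
      · rintro ⟨z, x, -, y, -, hy⟩
        exact ⟨x, y, hy⟩

/-! ### From axioms to semantic properties -/

theorem Fm.sat_induction {m n : ℕ} (φ : Fm m (n + 1)) (A : Fin m → Set S.carrier)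
    (v : Fin n → S.carrier) : φ.induction.Sat S A v ↔
      (φ.Sat S A (Matrix.vecCons 0 v) ∧ (∀ x, φ.Sat S A (Matrix.vecCons x v) →
        φ.Sat S A (Matrix.vecCons (S.succ x) v)) → ∀ x, φ.Sat S A (Matrix.vecCons x v)) := by
  have h0 : (fun i => ((Matrix.vecCons 0 (fun i => ♯i) : Fin (n + 1) → Tm n) i).eval S v) =
      Matrix.vecCons 0 v := by
    funext i
    refine Fin.cases rfl (fun i => rfl) i
  have h1 : ∀ x, (fun i => ((Matrix.vecCons (.succ ♯0) (fun i => ♯i.succ) :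
      Fin (n + 1) → Tm (n + 1)) i).eval S (Matrix.vecCons x v)) =
      Matrix.vecCons (S.succ x) v := by
    intro x
    funext i
    refine Fin.cases rfl (fun i => rfl) i
  simp only [Fm.induction, Fm.Sat, Fm.substNum, Fm.sat_subst, h0, h1, id]

theorem Fm.sat_collection {m n : ℕ} (φ : Fm m (n + 2)) (A : Fin m → Set S.carrier)
    (v : Fin n → S.carrier) : φ.collection.Sat S A v ↔
      ∀ a, (∀ x < a, ∃ y, φ.Sat S A (Matrix.vecCons y (Matrix.vecCons x v))) →
        ∃ c, ∀ x < a, ∃ y < c, φ.Sat S A (Matrix.vecCons y (Matrix.vecCons x v)) := by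
  have h1 : ∀ y x a : S.carrier, (fun i => ((Matrix.vecCons ♯0 (Matrix.vecCons ♯1
      (fun i => ♯i.succ.succ.succ)) : Fin (n + 2) → Tm (n + 3)) i).eval S
        (Matrix.vecCons y (Matrix.vecCons x (Matrix.vecCons a v)))) =
      Matrix.vecCons y (Matrix.vecCons x v) := by
    intro y x a
    funext i
    refine Fin.cases rfl (fun i => Fin.cases rfl (fun i => rfl) i) i
  have h2 : ∀ y x c a : S.carrier, (fun i => ((Matrix.vecCons ♯0 (Matrix.vecCons ♯1
      (fun i => ♯i.succ.succ.succ.succ)) : Fin (n + 2) → Tm (n + 4)) i).eval S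
        (Matrix.vecCons y (Matrix.vecCons x (Matrix.vecCons c (Matrix.vecCons a v))))) =
      Matrix.vecCons y (Matrix.vecCons x v) := by
    intro y x c a
    funext i
    refine Fin.cases rfl (fun i => Fin.cases rfl (fun i => rfl) i) i
  simp only [Fm.collection, Fm.sat_ball, Fm.sat_bex, Fm.Sat, Fm.substNum, Fm.sat_subst, h1, h2, id]
  rfl

theorem Fm.sat_comprehension {m n : ℕ} (φ ψ : Fm m (n + 1)) (A : Fin m → Set S.carrier)
    (v : Fin n → S.carrier) : (φ.comprehension ψ).Sat S A v ↔
      ((∀ x, φ.Sat S A (Matrix.vecCons x v) ↔ ψ.Sat S A (Matrix.vecCons x v)) →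
        {x | φ.Sat S A (Matrix.vecCons x v)} ∈ S.sets) := by
  simp only [Fm.comprehension, Fm.Sat, Fm.sat_subst, ← iff_iff_implies_and_implies]
  refine imp_congr_right fun _ => ⟨?_, fun h => ⟨_, h, fun x => Iff.rfl⟩⟩
  rintro ⟨X, hX, h⟩
  convert hX using 1
  ext x
  exact (h x).symm

theorem sat_betaEq [S.Arith] {m n : ℕ} (a b i r : Tm n) (A : Fin m → Set S.carrier)
    (v : Fin n → S.carrier) : (betaEq a b i r).Sat S A v ↔
      Beta (a.eval S v) (b.eval S v) (i.eval S v) (r.eval S v) := by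
  simp only [betaEq, Fm.Sat, Beta, ← succ_eq']
  refine and_congr Iff.rfl (exists_congr fun q => ?_)
  change Tm.eval S _ a.shift = q * Tm.eval S _ (Tm.shift _) + Tm.eval S _ r.shift ↔ _
  rw [Tm.eval_shift, Tm.eval_shift, Tm.eval_shift]
  rfl

theorem arith_of_models (h : S.Models (robinsonQ ∪ IDelta0)) : S.Arith := by
  have q : ∀ φ ∈ robinsonQ, S.Satisfies φ := fun φ hφ => h φ (.inl hφ)
  simp only [robinsonQ, Set.mem_insert_iff, Set.mem_singleton_iff, forall_eq_or_imp,
    forall_eq] at q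
  obtain ⟨h1, h2, h3, h4, h5, h6, h7, h8⟩ := q
  refine ⟨h1, h2, h3, h4, h5, h6, h7, fun x y => ⟨(h8 x y).1, (h8 x y).2⟩, ?_⟩
  intro P hP h0 hs
  obtain ⟨m, N, A, τ, φ, hA, hφ, hPφ⟩ := hP.exists_formula
  have hPφ' : ∀ x, P x ↔ φ.Sat S A (Matrix.vecCons x (env τ ![])) := fun x => hPφ x ![]
  have := (Fm.satisfies_close _).1 (h _ (.inr ⟨m, N, φ, hφ, rfl⟩)) A hA (env τ ![])
  simp only [Fm.sat_induction, ← hPφ'] at this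
  exact this ⟨h0, hs⟩

theorem isCohModel_of_models [S.Arith] (h : S.Models (RCA0star ∪ {finCOH})) : S.IsCohModel where
  collection P hP := by
    obtain ⟨m, N, A, τ, φ, hA, hφ, hPφ⟩ := hP.exists_formula₂
    have hPφ' : ∀ y x, P y x ↔
        φ.Sat S A (Matrix.vecCons y (Matrix.vecCons x (env τ ![]))) := fun y x => hPφ y x ![]
    have := (Fm.satisfies_close _).1 (h _ (.inl (.inl (.inl (.inr (.inr
      ⟨m, N, φ, .delta0 hφ, rfl⟩)))))) A hA (env τ ![])
    simpa only [Fm.sat_collection, ← hPφ'] using this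
  comprehension P hP := by
    obtain ⟨m, N, A, τ, φ, hA, hφ, hPφ⟩ := hP.exists_formula
    have hPφ' : ∀ x, P x ↔ φ.Sat S A (Matrix.vecCons x (env τ ![])) := fun x => hPφ x ![]
    -- A `Δ⁰₀` formula is both `Σ⁰₁` and `Π⁰₁`, so it is paired with itself and the equivalence
    -- hypothesis is trivial.
    have := (Fm.satisfies_close _).1 (h _ (.inl (.inr
      ⟨m, N, φ, φ, .delta0 hφ, .delta0 hφ, rfl⟩))) A hA (env τ ![])
    simpa only [Fm.sat_comprehension, ← hPφ', implies_true, true_imp_iff] using this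
  exp n := by
    have := h _ (.inl (.inl (.inr rfl)))
    simp only [expTotal, powTwoEq, Str.Satisfies, Fm.Sat, Fm.sat_ball, sat_betaEq] at this
    obtain ⟨y, a, c, h0, hs, hy⟩ := this n
    refine ⟨a, c, y, h0, fun i hi => ?_, hy⟩
    rw [← succ_eq']
    exact hs i hi
  coh l R hR := by
    have := h _ (.inr rfl)
    simp only [finCOH, Str.Satisfies, Fm.Sat, Fm.sat_ball] at this
    exact this l R hR

end

end SOA

theorem theorem2p3 :
    ∀ φ ∈ SOA.ISigma1, SOA.Theory.Entails.{u} (SOA.RCA0star ∪ {SOA.finCOH}) φ := by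
  rintro _ ⟨m, n, φ, hφ, rfl⟩ S hS
  have hArith : S.Arith := SOA.arith_of_models fun ψ hψ => hS ψ (.inl (.inl (.inl
    (hψ.imp id Or.inl))))
  rw [SOA.Fm.satisfies_close]
  intro A hA v
  obtain ⟨Q, hQ, hφQ⟩ := hφ.exists_delta0Rel hA
  rw [SOA.Fm.sat_induction]
  simp only [hφQ]
  rintro ⟨h0, hs⟩
  refine (SOA.isCohModel_of_models hS).sigma1_induction
    (P := fun y x => Q y (Matrix.vecCons x v)) ?_ h0 fun x hx => ?_
  -- The witness and the induction variable remain arguments; the other free variables are frozen at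
  -- their values `v i`.
  · convert hQ.subst_arg (k := 2) (Matrix.vecCons (.inl 0)
      (Matrix.vecCons (.inl 1) (fun i => .inr (v i)))) using 3 with w
    · rfl
    · funext i
      refine Fin.cases ?_ (fun i => ?_) i <;> simp [SOA.env]
  · rw [← SOA.Str.Arith.succ_eq']
    exact hs x hx
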